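/- **Conventions.** Let $V$ be a finite set. A function $f\colon 2^V\to\mathbb R$ is submodular if $f(X)+f(Y)\ge f(X\cup Y)+f(X\cap Y)$ for all $X,Y\subseteq V$, and $\arg\min f$ is the set of its minimizers. A *compact representation* of a family $\mathcal L\subseteq 2^V$ is a partition of $V$ into blocks $U_0,U_1,\dots,U_b,U_\infty$, where only $U_0$ and $U_\infty$ may be empty, together with a directed acyclic graph $G(\mathcal L)$ on the vertex set $\{U_0,\dots,U_b\}$ whose unique sink is $U_0$, such that every member of $\mathcal L$ contains $U_0$, is disjoint from $U_\infty$ and is a union of $U_0$ and some of $U_1,\dots,U_b$, and such that a set $\mathcal Z\ni U_0$ of vertices of $G(\mathcal L)$ has no outgoing edge if and only if $\bigcup_{U\in\mathcal Z}U\in\mathcal L$. *Robust Submodular Minimizer for $k=2$*: given $V$, $d\in\mathbb N$ and two submodular functions $f_1,f_2\colon 2^V\to\mathbb R$, each $f_i$ through a compact representation of $\arg\min f_i$, find a set $X\subseteq V$ such that for each $i\in\{1,2\}$ there is $Y_i\in\arg\min f_i$ with $|X\mathbin{\triangle}Y_i|\le d$ (a *solution*), or detect that no such set exists. The *combined graph*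 $\tilde G$ of the two representations has the vertices $s,t$ and two copies $v^1,v^2$ of each $v\in V$. For each $i\in\{1,2\}$ it has the following edges of cost $+\infty$: $u^iv^i$ if $u$ and $v$ lie in the same block of the $i$-th representation, or if its graph has an edge from the block of $u$ to the block of $v$; $u^is$ and $su^i$ if $u$ lies in its block $U_0$; $u^it$ and $tu^i$ if $u$ lies in its block $U_\infty$. Further it has the edges $v^1v^2$ and $v^2v^1$ of cost $1$ for all $v\in V$. An $(s,t)$-cut is a vertex set $Z$ with $s\in Z$ and $t\notin Z$, and $\kappa(Z)$ is the total cost of the edges leaving $Z$. **Theorem.** 1. Let $(V,f_1,f_2,d)$ be an instance as above, let $Z$ be a minimum-cost $(s,t)$-cut of $\tilde G$, and let $Y_i=\{v\in V: v^i\in Z\}$. Then $Y_i\in\arg\min f_i$ for $i=1,2$, and $$\kappa(Z)=|Y_1\mathbin{\triangle}Y_2|=\min\{|Y_1'\mathbin{\triangle}Y_2'| : Y_1'\in\arg\min f_1,\ Y_2'\in\arg\min f_2\}.$$ The instance has a solution if and only if $\kappa(Z)\le 2d$. If $\kappa(Z)\le 2d$, then every set $X=(Y_1\cap Y_2)\cup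 Z_1\cup Z_2$ with $Z_1\subseteq Y_1\setminus Y_2$, $|Z_1|=\lfloor|Y_1\setminus Y_2|/2\rfloor$, $Z_2\subseteq Y_2\setminus Y_1$ and $|Z_2|=\lfloor|Y_2\setminus Y_1|/2\rfloor$ is a solution. 2. Robust Submodular Minimizer for $k=2$ can be solved in polynomial time by a single minimum $(s,t)$-cut computation in $\tilde G$. That is, there are three programs for a random access machine (with addition and truncated subtraction as its arithmetic, each elementary instruction and each test counting as one step) and a polynomial $p$ such that: the first, on every instance with $|V|=n$, constructs $\tilde G$ within $p(n)$ steps; the second, on every network with $m$ vertices, two distinct terminals and edge costs in $\{1,+\infty\}$, computes a minimum-cost $(s,t)$-cut within $p(m)$ steps; the third, given an instance with $|V|=n$ and any minimum-cost $(s,t)$-cut $Z$ of its graph $\tilde G$, within $p(n)$ steps outputs a set $X$ as described in 1 if $\kappa(Z)\le 2d$, and "no" otherwise; and the three programs run one after the other, on every instance with $|V|=n$, within $p(n)$ steps output a solution if there is one, and "no" otherwise. -/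

import Mathlib

/-! ## Robust submodular minimization -/

/-- Submodularity of a set function `f : 2^V → ℝ`. -/
def IsSubmodular {V : Type} [DecidableEq V] (f : Finset V → ℝ) : Prop :=
  ∀ X Y : Finset V, f (X ∪ Y) + f (X ∩ Y) ≤ f X + f Y

/-- The family `arg min f` of all minimizers of a set function. -/
def argminSets {V : Type} (f : Finset V → ℝ) : Set (Finset V) :=
  {Y | ∀ Y' : Finset V, f Y ≤ f Y'}

/-- `X` is a solution of the instance `(V, f₁, …, f_k, d)` of Robust Submodular Minimizer:
every `f i` has a minimizer at distance at most `d` from `X`. -/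
def IsRobustSolution {V : Type} [DecidableEq V] {k : ℕ} (f : Fin k → Finset V → ℝ) (d : ℕ)
    (X : Finset V) : Prop :=
  ∀ i, ∃ Y ∈ argminSets (f i), (symmDiff X Y).card ≤ d

/-! ## Compact representations of distributive lattices -/

/-- The data of a compact representation over the ground set `V = {0, …, n-1}`: a labelling of `V`
by the `b + 2` block names `0, 1, …, b, ∞` (the name `∞` is `Fin.last (b + 1)`) and a directed
graph on the block names `0, 1, …, b`. -/
structure CompactRep (n : ℕ) where
  b : ℕ
  block : Fin n → Fin (b + 2)
  edge : Fin (b + 1) → Fin (b + 1) → Prop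

namespace CompactRep

variable {n : ℕ}

/-- The block `U_j`, for `j ∈ {0, 1, …, b, ∞}`. -/
def U (R : CompactRep n) (j : Fin (R.b + 2)) : Finset (Fin n) :=
  Finset.univ.filter fun v => R.block v = j

/-- The union of the blocks named in `Z ⊆ {0, …, b}`. -/
def union (R : CompactRep n) (Z : Finset (Fin (R.b + 1))) : Finset (Fin n) :=
  Z.biUnion fun j => R.U j.castSucc

/-- `R` is a compact representation of the family `L` of subsets of `V`.
Only `U_0` and `U_∞` may be empty.
Since `U_0` may be empty, the last field speaks about the vertex sets that contain `U_0`;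
for nonempty `U_0` this is the same as speaking about all nonempty vertex sets. -/
structure Represents (R : CompactRep n) (L : Set (Finset (Fin n))) : Prop where
  block_nonempty : ∀ j : Fin (R.b + 2), j ≠ 0 → j ≠ Fin.last (R.b + 1) → (R.U j).Nonempty
  zero_subset : ∀ X ∈ L, R.U 0 ⊆ X
  disjoint_last : ∀ X ∈ L, Disjoint X (R.U (Fin.last (R.b + 1)))
  exists_union : ∀ X ∈ L, ∃ J : Finset (Fin (R.b + 1)), 0 ∈ J ∧ X = R.union J
  acyclic : ∀ j, ¬ Relation.TransGen R.edge j j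
  sink_iff : ∀ j, (∀ j', ¬ R.edge j j') ↔ j = 0
  closed_iff : ∀ Z : Finset (Fin (R.b + 1)), 0 ∈ Z →
    ((∀ j ∈ Z, ∀ j', j' ∉ Z → ¬ R.edge j j') ↔ R.union Z ∈ L)

end CompactRep

/-! ## Networks and cuts -/

/-- A directed graph with edge costs in `ℕ ∪ {∞}` and two distinct terminals. -/
structure Network (W : Type) where
  Adj : W → W → Prop
  cost : W → W → ℕ∞
  s : W
  t : W
  s_ne_t : s ≠ t

namespace Network

variable {W : Type}

open Classical in
/-- The cut function `κ(Z)`, the total cost of the edges that leave `Z`. -/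
noncomputable def cutCost [Fintype W] (N : Network W) (Z : Finset W) : ℕ∞ :=
  ∑ e ∈ Finset.univ.filter (fun e : W × W => e.1 ∈ Z ∧ e.2 ∉ Z ∧ N.Adj e.1 e.2), N.cost e.1 e.2

/-- `(s,t)`-cuts, as sets of vertices. -/
def IsCut (N : Network W) (Z : Finset W) : Prop := N.s ∈ Z ∧ N.t ∉ Z

/-- Minimum-cost `(s,t)`-cuts. -/
def IsMinCut [Fintype W] (N : Network W) (Z : Finset W) : Prop :=
  N.IsCut Z ∧ ∀ Z', N.IsCut Z' → N.cutCost Z ≤ N.cutCost Z'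

/-- All edges have cost `1` or `∞`. -/
def UnitOrInfinite (N : Network W) : Prop :=
  ∀ x y, N.Adj x y → N.cost x y = 1 ∨ N.cost x y = ⊤

end Network

/-! ## The combined graph of two compact representations -/

/-- The vertices of the combined graph: the terminals and two copies of `V`. -/
abbrev CutVertex (n : ℕ) : Type := Fin 2 ⊕ (Fin 2 × Fin n)

namespace CutVertex

variable {n : ℕ}

def src : CutVertex n := Sum.inl 0

def snk : CutVertex n := Sum.inl 1

/-- The copy `v^i` of the element `v`. -/
def copy (i : Fin 2) (v : Fin n) : CutVertex n := Sum.inr (i, v)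

/-- The numbering `s ↦ 0`, `t ↦ 1`, `v^i ↦ 2 + (v + n * i)` of the vertices. -/
def numbering (n : ℕ) : CutVertex n ≃ Fin (2 + 2 * n) :=
  (Equiv.sumCongr (Equiv.refl (Fin 2)) finProdFinEquiv).trans finSumFinEquiv

end CutVertex

open CutVertex in
/-- The edges of the graphs `G^1` and `G^2`, in which each block is expanded to a complete graph,
the block `U_0` is joined with `s` and the block `U_∞` with `t` in both directions. -/
inductive BlockEdge {n : ℕ} (R : Fin 2 → CompactRep n) : CutVertex n → CutVertex n → Prop
  | same (i : Fin 2) (u v : Fin n) (h : (R i).block u = (R i).block v) :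
      BlockEdge R (copy i u) (copy i v)
  | arc (i : Fin 2) (u v : Fin n) (j j' : Fin ((R i).b + 1))
      (hu : (R i).block u = j.castSucc) (hv : (R i).block v = j'.castSucc)
      (h : (R i).edge j j') : BlockEdge R (copy i u) (copy i v)
  | toSrc (i : Fin 2) (u : Fin n) (h : (R i).block u = 0) : BlockEdge R (copy i u) src
  | ofSrc (i : Fin 2) (u : Fin n) (h : (R i).block u = 0) : BlockEdge R src (copy i u)
  | toSnk (i : Fin 2) (u : Fin n) (h : (R i).block u = Fin.last ((R i).b + 1)) :
      BlockEdge R (copy i u) snk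
  | ofSnk (i : Fin 2) (u : Fin n) (h : (R i).block u = Fin.last ((R i).b + 1)) :
      BlockEdge R snk (copy i u)

open CutVertex in
/-- The edges that connect the two copies of each element in both directions. -/
inductive LinkEdge {n : ℕ} : CutVertex n → CutVertex n → Prop
  | forth (v : Fin n) : LinkEdge (copy 0 v) (copy 1 v)
  | back (v : Fin n) : LinkEdge (copy 1 v) (copy 0 v)

open Classical in
/-- The combined network: block edges cost `∞`, link edges cost `1`. -/
noncomputable def combinedNetwork {n : ℕ} (R : Fin 2 → CompactRep n) : Network (CutVertex n) where
  Adj x y := BlockEdge R x y ∨ LinkEdge x y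
  cost x y := if BlockEdge R x y then ⊤ else 1
  s := CutVertex.src
  t := CutVertex.snk
  s_ne_t := by simp [CutVertex.src, CutVertex.snk]

/-- The set `Y_i = {v : v^i ∈ Z}`. -/
def cutSide {n : ℕ} (Z : Finset (CutVertex n)) (i : Fin 2) : Finset (Fin n) :=
  Finset.univ.filter fun v => CutVertex.copy i v ∈ Z

/-- `X` arises by halving the difference of `Y₁` and `Y₂`: it consists of `Y₁ ∩ Y₂`, half of
`Y₁ \ Y₂` and half of `Y₂ \ Y₁`, both rounded down. -/
def IsHalving {V : Type} [DecidableEq V] (Y₁ Y₂ X : Finset V) : Prop :=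
  ∃ Z₁ Z₂ : Finset V, Z₁ ⊆ Y₁ \ Y₂ ∧ Z₁.card = (Y₁ \ Y₂).card / 2 ∧
    Z₂ ⊆ Y₂ \ Y₁ ∧ Z₂.card = (Y₂ \ Y₁).card / 2 ∧ X = (Y₁ ∩ Y₂) ∪ Z₁ ∪ Z₂

/-! ## Random access machines with a step count -/

/-- A memory state of a random access machine with registers `reg x` and arrays `arr a`, all of
whose cells hold natural numbers. -/
structure RAMState where
  reg : ℕ → ℕ
  arr : ℕ → ℕ → ℕ

namespace RAMState

def setReg (σ : RAMState) (x v : ℕ) : RAMState :=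
  { σ with reg := Function.update σ.reg x v }

def setArr (σ : RAMState) (a i v : ℕ) : RAMState :=
  { σ with arr := Function.update σ.arr a (Function.update (σ.arr a) i v) }

end RAMState

/-- Programs. There is no multiplication, so that a step lengthens the numbers in memory by at most
one bit and the unit-cost step count is polynomially related to the running time of a Turing
machine. -/
inductive RAMProg where
  /-- `reg x := c` -/
  | const (x c : ℕ)
  /-- `reg x := reg y + reg z` -/
  | add (x y z : ℕ)
  /-- `reg x := max (reg y - reg z) 0` -/
  | sub (x y z : ℕ)
  /-- `reg x := arr a [reg y]` -/
  | load (x a y : ℕ)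
  /-- `arr a [reg x] := reg y` -/
  | store (a x y : ℕ)
  | seq (p q : RAMProg)
  /-- if `reg x ≠ 0` then `p` else `q` -/
  | ite (x : ℕ) (p q : RAMProg)
  /-- while `reg x ≠ 0` do `p` -/
  | loop (x : ℕ) (p : RAMProg)

/-- `RAMRun p σ k τ`: started in `σ`, the program `p` halts in `τ` after exactly `k` steps.
Each elementary instruction and each test counts as one step. -/
inductive RAMRun : RAMProg → RAMState → ℕ → RAMState → Prop
  | const (σ : RAMState) (x c : ℕ) : RAMRun (.const x c) σ 1 (σ.setReg x c)
  | add (σ : RAMState) (x y z : ℕ) :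
      RAMRun (.add x y z) σ 1 (σ.setReg x (σ.reg y + σ.reg z))
  | sub (σ : RAMState) (x y z : ℕ) :
      RAMRun (.sub x y z) σ 1 (σ.setReg x (σ.reg y - σ.reg z))
  | load (σ : RAMState) (x a y : ℕ) :
      RAMRun (.load x a y) σ 1 (σ.setReg x (σ.arr a (σ.reg y)))
  | store (σ : RAMState) (a x y : ℕ) :
      RAMRun (.store a x y) σ 1 (σ.setArr a (σ.reg x) (σ.reg y))
  | seq {p q : RAMProg} {σ τ υ : RAMState} {k l : ℕ} :
      RAMRun p σ k τ → RAMRun q τ l υ → RAMRun (.seq p q) σ (k + l) υ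
  | iteTrue {x : ℕ} {p q : RAMProg} {σ τ : RAMState} {k : ℕ} :
      σ.reg x ≠ 0 → RAMRun p σ k τ → RAMRun (.ite x p q) σ (k + 1) τ
  | iteFalse {x : ℕ} {p q : RAMProg} {σ τ : RAMState} {k : ℕ} :
      σ.reg x = 0 → RAMRun q σ k τ → RAMRun (.ite x p q) σ (k + 1) τ
  | loopDone {x : ℕ} {p : RAMProg} {σ : RAMState} :
      σ.reg x = 0 → RAMRun (.loop x p) σ 1 σ
  | loopStep {x : ℕ} {p : RAMProg} {σ τ υ : RAMState} {k l : ℕ} :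
      σ.reg x ≠ 0 → RAMRun p σ k τ → RAMRun (.loop x p) τ l υ →
        RAMRun (.loop x p) σ (k + l + 1) υ

/-- Started in `σ`, the program `p` halts after at most `T` steps in a state satisfying `Q`. -/
def HaltsWithin (p : RAMProg) (σ : RAMState) (T : ℕ) (Q : RAMState → Prop) : Prop :=
  ∃ k τ, RAMRun p σ k τ ∧ k ≤ T ∧ Q τ

/-! ## Memory layout of inputs and outputs -/

open Classical in
/-- Array `a` holds the block labels (with `∞` written as `b + 1`), and array `a'` holds the
adjacency matrix, row by row, of the compact representation. -/
def HoldsRep {n : ℕ} (R : CompactRep n) (a a' : ℕ) (σ : RAMState) : Prop :=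
  (∀ v : Fin n, σ.arr a v = (R.block v : ℕ)) ∧
    ∀ j j' : Fin (R.b + 1), σ.arr a' ((j : ℕ) * (R.b + 1) + j') = if R.edge j j' then 1 else 0

/-- The memory holds the instance with ground set `{0, …, n-1}`, the compact representations `R 0`
and `R 1` of the two functions, and the number `d`. -/
def HoldsInstance {n : ℕ} (R : Fin 2 → CompactRep n) (d : ℕ) (σ : RAMState) : Prop :=
  σ.arr 0 0 = n ∧ σ.arr 0 1 = d ∧ σ.arr 0 2 = (R 0).b ∧ σ.arr 0 3 = (R 1).b ∧
    HoldsRep (R 0) 1 2 σ ∧ HoldsRep (R 1) 3 4 σ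

open Classical in
/-- The memory holds a network with costs in `{1, ∞}`: the number of vertices and the numbers of
`s` and `t` in array `5`, and in array `6` the cost matrix, row by row
(`0` no edge, `1` cost `1`, `2` cost `∞`). -/
def HoldsNetwork {W : Type} {m : ℕ} (e : W ≃ Fin m) (N : Network W) (σ : RAMState) : Prop :=
  σ.arr 5 0 = m ∧ σ.arr 5 1 = (e N.s : ℕ) ∧ σ.arr 5 2 = (e N.t : ℕ) ∧
    ∀ x y, σ.arr 6 ((e x : ℕ) * m + e y) =
      if N.Adj x y then (if N.cost x y = ⊤ then 2 else 1) else 0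

open Classical in
/-- Array `a` holds the characteristic vector of `Z`. -/
def HoldsSet {W : Type} {m : ℕ} (e : W ≃ Fin m) (Z : Finset W) (a : ℕ) (σ : RAMState) : Prop :=
  ∀ x, σ.arr a (e x : ℕ) = if x ∈ Z then 1 else 0

/-- The memory holds the answer "yes" with the witness `X`. -/
def AnswersYes {n : ℕ} (X : Finset (Fin n)) (σ : RAMState) : Prop :=
  σ.arr 8 0 = 1 ∧ HoldsSet (Equiv.refl (Fin n)) X 9 σ

/-- The memory holds the answer "no". -/
def AnswersNo (σ : RAMState) : Prop := σ.arr 8 0 = 0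

/-! ## Rules for bounding the running time of programs -/

/-! By `CompactRep.Represents.mem_iff`, a set minimizes `f i` exactly when it contains `U_0`, avoids
`U_∞` and is closed under the links between elements. The infinite edges of the combined graph
express just these conditions, so an `(s,t)`-cut has finite cost if and only if its two sides are
minimizers (`blockClosed_iff`, `cutCost_of_not_blockClosed`). Each `v` in the symmetric difference
of the sides then contributes exactly one leaving edge, of cost `1` (`cutCost_of_blockClosed`).
Minimum cuts are therefore closest pairs of minimizers. If a solution exists, the triangle
inequality gives a pair at distance at most `2 * d`. Conversely, halving both differences of such a
pair gives a set within distance `d` of each of them (`IsHalving.card_symmDiff_le`).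

For the running time, programs without loops are handled by computing weakest preconditions
(`HaltsWithin.of_wp`), loops by invariants with a decreasing bound (`HaltsWithin.loop`,
`HaltsWithin.for_loop`), and everything a program does not write by the syntactic `RAMRun.frame`.

The minimum cut program is the method of augmenting paths. Infinite costs become `m * m + 1`, more
than any cut of finite edges can cost, so the sum of all capacities is polynomial in `m` and pushing
one unit per round is fast enough. Flows never appear explicitly: `IsResidual` only says that every
cut has lost the same amount `F`. Pushing a unit along a path raises `F` by one
(`haltsWithin_augment`). When `t` is not reached, the reached set has residual value `0`, and hence
is a minimum cut (`IsResidual.le_of_isClosedUnder`). -/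

namespace RAMState

variable (σ : RAMState)

@[simp] theorem reg_setReg_self (x v : ℕ) : (σ.setReg x v).reg x = v := by
  simp [setReg]

@[simp] theorem reg_setReg_of_ne {x y : ℕ} (v : ℕ) (h : y ≠ x) :
    (σ.setReg x v).reg y = σ.reg y := by
  simp [setReg, h]

@[simp] theorem arr_setReg (x v : ℕ) : (σ.setReg x v).arr = σ.arr := rfl

@[simp] theorem reg_setArr (a i v : ℕ) : (σ.setArr a i v).reg = σ.reg := rfl

theorem arr_setArr_self (a i v j : ℕ) :
    (σ.setArr a i v).arr a j = if j = i then v else σ.arr a j := by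
  simp [setArr, Function.update_apply]

@[simp] theorem arr_setArr_of_ne {a b : ℕ} (i v : ℕ) (h : b ≠ a) :
    (σ.setArr a i v).arr b = σ.arr b := by
  simp [setArr, h]

end RAMState

namespace RAMProg

/-- The registers that a program may change. -/
def regs : RAMProg → List ℕ
  | const x _ => [x]
  | add x _ _ => [x]
  | sub x _ _ => [x]
  | load x _ _ => [x]
  | store _ _ _ => []
  | seq p q => p.regs ++ q.regs
  | ite _ p q => p.regs ++ q.regs
  | loop _ p => p.regs

/-- The arrays that a program may change. -/
def arrs : RAMProg → List ℕ
  | store a _ _ => [a]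
  | seq p q => p.arrs ++ q.arrs
  | ite _ p q => p.arrs ++ q.arrs
  | loop _ p => p.arrs
  | _ => []

/-- `τ` arises from `σ` by changing only what `p` may change. -/
structure Frame (p : RAMProg) (σ τ : RAMState) : Prop where
  reg : ∀ x, x ∉ p.regs → τ.reg x = σ.reg x
  arr : ∀ a, a ∉ p.arrs → τ.arr a = σ.arr a

theorem Frame.refl (p : RAMProg) (σ : RAMState) : p.Frame σ σ := ⟨fun _ _ => rfl, fun _ _ => rfl⟩

theorem Frame.trans {p : RAMProg} {σ τ υ : RAMState} (h : p.Frame σ τ) (h' : p.Frame τ υ) :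
    p.Frame σ υ :=
  ⟨fun x hx => (h'.reg x hx).trans (h.reg x hx), fun a ha => (h'.arr a ha).trans (h.arr a ha)⟩

theorem Frame.of_subset {p q : RAMProg} {σ τ : RAMState} (h : p.Frame σ τ)
    (hr : p.regs ⊆ q.regs) (ha : p.arrs ⊆ q.arrs) : q.Frame σ τ :=
  ⟨fun x hx => h.reg x fun h' => hx (hr h'), fun a hx => h.arr a fun h' => hx (ha h')⟩

/-- The weakest precondition of a program without loops. -/
def wp : RAMProg → (RAMState → Prop) → RAMState → Prop
  | const x c, Q, σ => Q (σ.setReg x c)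
  | add x y z, Q, σ => Q (σ.setReg x (σ.reg y + σ.reg z))
  | sub x y z, Q, σ => Q (σ.setReg x (σ.reg y - σ.reg z))
  | load x a y, Q, σ => Q (σ.setReg x (σ.arr a (σ.reg y)))
  | store a x y, Q, σ => Q (σ.setArr a (σ.reg x) (σ.reg y))
  | seq p q, Q, σ => p.wp (q.wp Q) σ
  | ite x p q, Q, σ => (σ.reg x ≠ 0 → p.wp Q σ) ∧ (σ.reg x = 0 → q.wp Q σ)
  | loop _ _, _, _ => False

/-- The step count of a program without loops. -/
def time : RAMProg → ℕ
  | seq p q => p.time + q.time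
  | ite _ p q => max p.time q.time + 1
  | _ => 1

end RAMProg

/-- The cells a program may write can be read off its syntax. Later proofs thus get the preservation
of a register or an array from a decidable list membership, without carrying it through the loop
invariants. -/
theorem RAMRun.frame {p : RAMProg} {σ τ : RAMState} {k : ℕ} (h : RAMRun p σ k τ) :
    p.Frame σ τ := by
  induction h with
  | const | add | sub | load =>
    exact ⟨fun y hy => RAMState.reg_setReg_of_ne _ _ (by simpa [RAMProg.regs] using hy),
      fun a _ => rfl⟩
  | store =>
    exact ⟨fun y hy => rfl,
      fun a ha => RAMState.arr_setArr_of_ne _ _ _ (by simpa [RAMProg.arrs] using ha)⟩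
  | seq _ _ h₁ h₂ =>
    exact (h₁.of_subset (by simp [RAMProg.regs]) (by simp [RAMProg.arrs])).trans
      (h₂.of_subset (by simp [RAMProg.regs]) (by simp [RAMProg.arrs]))
  | iteTrue _ _ h | iteFalse _ _ h =>
    exact h.of_subset (by simp [RAMProg.regs]) (by simp [RAMProg.arrs])
  | loopDone => exact .refl _ _
  | loopStep _ _ _ h₁ h₂ => exact RAMProg.Frame.trans ⟨h₁.reg, h₁.arr⟩ h₂

namespace HaltsWithin

variable {p q : RAMProg} {σ : RAMState} {T T' : ℕ} {Q Q' : RAMState → Prop}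

theorem mono (h : HaltsWithin p σ T Q) (hT : T ≤ T') (hQ : ∀ τ, Q τ → Q' τ) :
    HaltsWithin p σ T' Q' := by
  obtain ⟨k, τ, hr, hk, hq⟩ := h
  exact ⟨k, τ, hr, hk.trans hT, hQ τ hq⟩

theorem frame (h : HaltsWithin p σ T Q) : HaltsWithin p σ T fun τ => Q τ ∧ p.Frame σ τ := by
  obtain ⟨k, τ, hr, hk, hq⟩ := h
  exact ⟨k, τ, hr, hk, hq, hr.frame⟩

theorem seq (h : HaltsWithin p σ T fun τ => HaltsWithin q τ T' Q) :
    HaltsWithin (.seq p q) σ (T + T') Q := by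
  obtain ⟨k, τ, hr, hk, l, υ, hr', hl, hq⟩ := h
  exact ⟨k + l, υ, .seq hr hr', Nat.add_le_add hk hl, hq⟩

theorem ite {x : ℕ} (h : σ.reg x ≠ 0 → HaltsWithin p σ T Q)
    (h' : σ.reg x = 0 → HaltsWithin q σ T Q) : HaltsWithin (.ite x p q) σ (T + 1) Q := by
  by_cases hx : σ.reg x = 0
  · obtain ⟨k, τ, hr, hk, hq⟩ := h' hx
    exact ⟨k + 1, τ, .iteFalse hx hr, by omega, hq⟩
  · obtain ⟨k, τ, hr, hk, hq⟩ := h hx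
    exact ⟨k + 1, τ, .iteTrue hx hr, by omega, hq⟩

/-- Loops need no exclusion by hypothesis, since their `wp` is `False`. -/
theorem of_wp (h : p.wp Q σ) : HaltsWithin p σ p.time Q := by
  induction p generalizing σ Q with
  | const => exact ⟨1, _, .const .., le_rfl, h⟩
  | add => exact ⟨1, _, .add .., le_rfl, h⟩
  | sub => exact ⟨1, _, .sub .., le_rfl, h⟩
  | load => exact ⟨1, _, .load .., le_rfl, h⟩
  | store => exact ⟨1, _, .store .., le_rfl, h⟩
  | seq p q hp hq => exact (((hp h).mono le_rfl fun τ => hq).seq)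
  | ite x p q hp hq =>
    exact ite (fun hx => (hp (h.1 hx)).mono (le_max_left _ _) fun _ => id)
      (fun hx => (hq (h.2 hx)).mono (le_max_right _ _) fun _ => id)
  | loop => exact h.elim

theorem wp_seq (h : p.wp (fun τ => HaltsWithin q τ T Q) σ) :
    HaltsWithin (.seq p q) σ (p.time + T) Q :=
  (of_wp h).seq

/-- A loop with an invariant that bounds the number of the remaining iterations. -/
theorem loop {x : ℕ} (I : ℕ → RAMState → Prop) {n : ℕ} (h0 : I n σ)
    (step : ∀ j τ, I j τ → τ.reg x ≠ 0 → p.Frame σ τ →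
      HaltsWithin p τ T fun υ => ∃ i < j, I i υ) :
    HaltsWithin (.loop x p) σ (n * (T + 1) + 1) fun τ => τ.reg x = 0 ∧ ∃ j, I j τ := by
  suffices H : ∀ n τ, I n τ → p.Frame σ τ →
      HaltsWithin (.loop x p) τ (n * (T + 1) + 1) fun τ => τ.reg x = 0 ∧ ∃ j, I j τ from
    H n σ h0 (.refl _ _)
  intro n
  induction n using Nat.strong_induction_on with
  | _ n ih =>
    intro τ hI hf
    by_cases hx : τ.reg x = 0
    · exact ⟨1, τ, .loopDone hx, by omega, hx, n, hI⟩
    · obtain ⟨k, υ, hr, hk, i, hi, hI'⟩ := step n τ hI hx hf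
      obtain ⟨l, ω, hr', hl, hq⟩ := ih i hi υ hI' (hf.trans hr.frame)
      refine ⟨k + l + 1, ω, .loopStep hx hr hr', ?_, hq⟩
      -- The drop of the bound from `n` to `i < n` pays for one iteration and its test.
      have : (i + 1) * (T + 1) ≤ n * (T + 1) := Nat.mul_le_mul_right _ hi
      linarith

/-- A loop that counts down. -/
theorem for_loop {x : ℕ} (I : ℕ → RAMState → Prop) {n : ℕ} (hx : σ.reg x = n) (h0 : I n σ)
    (step : ∀ j τ, I (j + 1) τ → τ.reg x = j + 1 → j < n → p.Frame σ τ →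
      HaltsWithin p τ T fun υ => I j υ ∧ υ.reg x = j) :
    HaltsWithin (.loop x p) σ (n * (T + 1) + 1) (I 0) := by
  refine (loop (fun j τ => I j τ ∧ τ.reg x = j ∧ j ≤ n) ⟨h0, hx, le_rfl⟩ ?_).mono le_rfl ?_
  · rintro j τ ⟨hI, hj, hn⟩ hx hf
    obtain ⟨i, rfl⟩ : ∃ i, j = i + 1 := ⟨j - 1, by omega⟩
    exact (step i τ hI hj hn hf).mono le_rfl fun υ h => ⟨i, by omega, h.1, h.2, by omega⟩
  · rintro τ ⟨h, j, hI, hj, -⟩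
    obtain rfl : j = 0 := hj ▸ h
    exact hI

end HaltsWithin

/-! ### Multiplication by repeated addition -/

namespace RAMProg

/-- Execution of the programs in a list one after the other. -/
def block : List RAMProg → RAMProg
  | [] => const 0 0
  | [p] => p
  | p :: q :: l => seq p (block (q :: l))

/-- `reg 20 := reg x * reg y`, with `reg 21` as a counter, provided that `reg 0` and `reg 1` hold
the constants `0` and `1`. -/
def mul (x y : ℕ) : RAMProg :=
  block [const 20 0, add 21 x 0, loop 21 (seq (sub 21 21 1) (add 20 20 y))]

end RAMProg

theorem HaltsWithin.mul {x y B : ℕ} {σ : RAMState} {Q : RAMState → Prop}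
    (h0 : σ.reg 0 = 0) (h1 : σ.reg 1 = 1) (hx0 : x ≠ 20) (hy0 : y ≠ 20) (hy1 : y ≠ 21)
    (hB : σ.reg x ≤ B)
    (h : Q ((σ.setReg 21 0).setReg 20 (σ.reg x * σ.reg y))) :
    HaltsWithin (RAMProg.mul x y) σ (3 * B + 3) Q := by
  refine (HaltsWithin.wp_seq (T := 1 + (B * 3 + 1)) ?_).mono
    (by simp only [RAMProg.time]; omega) fun _ => id
  refine HaltsWithin.wp_seq (T := B * 3 + 1) ?_
  -- The invariant determines the whole state, so that the final state is known exactly and `Q` can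
  -- be arbitrary.
  refine (HaltsWithin.for_loop (T := 2) (n := σ.reg x)
    (fun j τ => τ = (σ.setReg 21 j).setReg 20 ((σ.reg x - j) * σ.reg y)) ?_ ?_ ?_).mono
    (by simp only [Nat.reduceAdd]; gcongr) ?_
  · simp [h0, hx0]
  · simp only [RAMState.setReg, RAMState.mk.injEq, and_true]
    funext z
    simp only [Function.update_apply]
    split_ifs <;> simp_all
  · rintro j τ rfl - hj -
    refine HaltsWithin.of_wp ?_
    simp only [RAMProg.wp, RAMState.setReg, RAMState.mk.injEq, and_true]
    refine ⟨?_, by simp [h1]⟩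
    funext z
    simp only [Function.update_apply]
    obtain ⟨c, hc⟩ : ∃ c, σ.reg x = j + 1 + c := ⟨σ.reg x - (j + 1), by omega⟩
    have e1 : σ.reg x - (j + 1) = c := by omega
    have e2 : σ.reg x - j = c + 1 := by omega
    rw [e1, e2]
    rcases eq_or_ne z 20 with rfl | h20
    · simp [hy0, hy1, add_mul]
    · rcases eq_or_ne z 21 with rfl | h21
      · simp [h1]
      · simp [h20, h21]
  · rintro τ rfl
    simpa using h

/-! ## Cuts of the combined network and pairs of minimizers -/

namespace CompactRep

variable {n : ℕ} {R : CompactRep n}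

/-- There is a block edge between copies of `u` and `v` in the same layer. -/
def Linked (R : CompactRep n) (u v : Fin n) : Prop :=
  R.block u = R.block v ∨ ∃ j j' : Fin (R.b + 1),
    R.block u = j.castSucc ∧ R.block v = j'.castSucc ∧ R.edge j j'

theorem mem_union {J : Finset (Fin (R.b + 1))} {v : Fin n} :
    v ∈ R.union J ↔ ∃ j ∈ J, R.block v = j.castSucc := by
  simp [union, U]

/-- This moves from the graph on the blocks to the expanded graph on the elements. Closure within a
block makes `Y` a union of blocks, and closure along arcs makes the set of its blocks closed in the
block graph. -/
theorem Represents.mem_iff {L : Set (Finset (Fin n))} (h : R.Represents L) (Y : Finset (Fin n)) :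
    Y ∈ L ↔ (∀ u v, R.Linked u v → u ∈ Y → v ∈ Y) ∧ (∀ u, R.block u = 0 → u ∈ Y) ∧
      ∀ u, R.block u = Fin.last (R.b + 1) → u ∉ Y := by
  constructor
  · intro hY
    refine ⟨?_, fun u hu => h.zero_subset Y hY (by simpa [U] using hu), fun u hu hu' =>
      Finset.disjoint_left.1 (h.disjoint_last Y hY) hu' (by simpa [U] using hu)⟩
    obtain ⟨J, hJ, rfl⟩ := h.exists_union Y hY
    have hcl := (h.closed_iff J hJ).2 hY
    intro u v huv hu
    obtain ⟨j, hj, huj⟩ := mem_union.1 hu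
    rcases huv with huv | ⟨k, k', hk, hk', hE⟩
    · exact mem_union.2 ⟨j, hj, huv ▸ huj⟩
    · obtain rfl : k = j := Fin.castSucc_injective _ (hk.symm.trans huj)
      exact mem_union.2 ⟨k', by_contra fun hn => hcl k hj k' hn hE, hk'⟩
  · rintro ⟨hL, h0, hl⟩
    classical
    -- The name `0` is added by hand because `U_0` may be empty and then has no element in `Y`.
    let J : Finset (Fin (R.b + 1)) :=
      Finset.univ.filter fun j => j = 0 ∨ ∃ u ∈ Y, R.block u = j.castSucc
    have hJ : ∀ j, j ∈ J ↔ j = 0 ∨ ∃ u ∈ Y, R.block u = j.castSucc := fun j => by simp [J]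
    have hY : Y = R.union J := by
      ext v
      rw [mem_union]
      constructor
      · intro hv
        have hne : R.block v ≠ Fin.last _ := fun hv' => hl v hv' hv
        refine ⟨(R.block v).castPred hne, (hJ _).2 (Or.inr ⟨v, hv, by simp⟩), by simp⟩
      · rintro ⟨j, hj, hv⟩
        rcases (hJ j).1 hj with rfl | ⟨u, hu, huj⟩
        · exact h0 v (by simpa using hv)
        · exact hL u v (Or.inl (huj.trans hv.symm)) hu
    rw [hY]
    refine (h.closed_iff J ((hJ 0).2 (Or.inl rfl))).1 fun j hj j' hj' hE => hj' ((hJ j').2 ?_)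
    by_cases hj0 : j' = 0
    · exact Or.inl hj0
    right
    -- The sink `0` has no outgoing edge, so `j` is in `J` because of an element of `Y`. The block
    -- `j'` is nonempty as well, so the edge between the blocks is visible on elements.
    have hjne : j ≠ 0 := fun h0 => (h.sink_iff j).2 h0 j' hE
    obtain ⟨u, hu, huj⟩ := ((hJ j).1 hj).resolve_left hjne
    obtain ⟨v, hv⟩ := h.block_nonempty j'.castSucc (by simpa using hj0) (Fin.castSucc_lt_last _).ne
    have hv : R.block v = j'.castSucc := by simpa [U] using hv
    exact ⟨v, hL u v (Or.inr ⟨j, j', huj, hv, hE⟩) hu, hv⟩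

/-- Representatives of the nonempty blocks `1, …, b` are distinct elements. The bound makes
arithmetic with block labels polynomial in `n`. -/
theorem Represents.b_le {L : Set (Finset (Fin n))} (h : R.Represents L) : R.b ≤ n := by
  have hne : ∀ k : Fin R.b, ∃ v, R.block v = k.succ.castSucc := fun k => by
    obtain ⟨v, hv⟩ := h.block_nonempty k.succ.castSucc
      (by simp) (Fin.castSucc_lt_last _).ne
    exact ⟨v, by simpa [U] using hv⟩
  choose g hg using hne
  have hinj : Function.Injective g := fun k l hkl => by
    have := (hg k).symm.trans (hkl ▸ hg l)
    exact Fin.succ_injective _ (Fin.castSucc_injective _ this)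
  simpa using Fintype.card_le_of_injective g hinj

end CompactRep

section CombinedNetwork

open CutVertex

variable {n : ℕ} {R : Fin 2 → CompactRep n}

theorem blockEdge_copy_copy {i : Fin 2} {u v : Fin n} :
    BlockEdge R (copy i u) (copy i v) ↔ (R i).Linked u v := by
  constructor
  · intro h
    -- The indices must be variables before `cases` can split the edge.
    generalize hx : copy i u = x at h
    generalize hy : copy i v = y at h
    cases h with
    | same k u' v' h =>
      simp only [copy, Sum.inr.injEq, Prod.mk.injEq] at hx hy
      obtain ⟨rfl, rfl⟩ := hx
      obtain ⟨-, rfl⟩ := hy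
      exact Or.inl h
    | arc k u' v' j j' hu hv h =>
      simp only [copy, Sum.inr.injEq, Prod.mk.injEq] at hx hy
      obtain ⟨rfl, rfl⟩ := hx
      obtain ⟨-, rfl⟩ := hy
      exact Or.inr ⟨j, j', hu, hv, h⟩
    | _ => simp [copy, src, snk] at hx hy
  · rintro (h | ⟨j, j', hu, hv, h⟩)
    · exact .same i u v h
    · exact .arc i u v j j' hu hv h

theorem not_blockEdge_of_ne {i i' : Fin 2} (h : i ≠ i') (u v : Fin n) :
    ¬ BlockEdge R (copy i u) (copy i' v) := by
  intro hE
  generalize hx : copy i u = x at hE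
  generalize hy : copy i' v = y at hE
  cases hE <;> simp_all [copy, src, snk]

theorem not_blockEdge_inl (a b : Fin 2) : ¬ BlockEdge R (Sum.inl a) (Sum.inl b) := by
  intro hE
  generalize hx : (Sum.inl a : CutVertex n) = x at hE
  generalize hy : (Sum.inl b : CutVertex n) = y at hE
  cases hE <;> simp_all [copy, src, snk]

theorem blockEdge_copy_src {i : Fin 2} {u : Fin n} :
    BlockEdge R (copy i u) src ↔ (R i).block u = 0 := by
  refine ⟨fun hE => ?_, .toSrc i u⟩
  generalize hx : copy i u = x at hE
  generalize hy : (src : CutVertex n) = y at hE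
  cases hE <;> simp [copy, src, snk] at hx hy
  obtain ⟨rfl, rfl⟩ := hx
  assumption

theorem blockEdge_src_copy {i : Fin 2} {u : Fin n} :
    BlockEdge R src (copy i u) ↔ (R i).block u = 0 := by
  refine ⟨fun hE => ?_, .ofSrc i u⟩
  generalize hx : copy i u = x at hE
  generalize hy : (src : CutVertex n) = y at hE
  cases hE <;> simp [copy, src, snk] at hx hy
  obtain ⟨rfl, rfl⟩ := hx
  assumption

theorem blockEdge_copy_snk {i : Fin 2} {u : Fin n} :
    BlockEdge R (copy i u) snk ↔ (R i).block u = Fin.last ((R i).b + 1) := by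
  refine ⟨fun hE => ?_, .toSnk i u⟩
  generalize hx : copy i u = x at hE
  generalize hy : (snk : CutVertex n) = y at hE
  cases hE <;> simp [copy, src, snk] at hx hy
  obtain ⟨rfl, rfl⟩ := hx
  assumption

theorem blockEdge_snk_copy {i : Fin 2} {u : Fin n} :
    BlockEdge R snk (copy i u) ↔ (R i).block u = Fin.last ((R i).b + 1) := by
  refine ⟨fun hE => ?_, .ofSnk i u⟩
  generalize hx : copy i u = x at hE
  generalize hy : (snk : CutVertex n) = y at hE
  cases hE <;> simp [copy, src, snk] at hx hy
  obtain ⟨rfl, rfl⟩ := hx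
  assumption

theorem linkEdge_copy_copy {i i' : Fin 2} {u v : Fin n} :
    LinkEdge (copy i u) (copy i' v) ↔ i ≠ i' ∧ u = v := by
  constructor
  · intro h
    generalize hx : copy i u = x at h
    generalize hy : copy i' v = y at h
    cases h <;> simp_all [copy]
  · rintro ⟨h, rfl⟩
    match i, i', h with
    | 0, 1, _ => exact .forth u
    | 1, 0, _ => exact .back u
    | 0, 0, h => exact absurd rfl h
    | 1, 1, h => exact absurd rfl h

theorem not_linkEdge_inl_left (a : Fin 2) (y : CutVertex n) : ¬ LinkEdge (Sum.inl a) y := by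
  intro h
  generalize hx : (Sum.inl a : CutVertex n) = x at h
  cases h <;> simp_all [copy]

theorem not_linkEdge_inl_right (a : Fin 2) (x : CutVertex n) : ¬ LinkEdge x (Sum.inl a) := by
  intro h
  generalize hy : (Sum.inl a : CutVertex n) = y at h
  cases h <;> simp_all [copy]

theorem mem_cutSide {Z : Finset (CutVertex n)} {i : Fin 2} {v : Fin n} :
    v ∈ cutSide Z i ↔ copy i v ∈ Z := by
  simp [cutSide]

/-- No block edge leaves `Z`. -/
def BlockClosed (R : Fin 2 → CompactRep n) (Z : Finset (CutVertex n)) : Prop :=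
  ∀ x y, BlockEdge R x y → x ∈ Z → y ∈ Z

/-- The three kinds of block edges match the three conditions of `Represents.mem_iff`. Edges into
`s` or out of `t` can never leave a cut. -/
theorem blockClosed_iff {L : Fin 2 → Set (Finset (Fin n))} (hR : ∀ i, (R i).Represents (L i))
    {Z : Finset (CutVertex n)} (hs : src ∈ Z) (ht : snk ∉ Z) :
    BlockClosed R Z ↔ ∀ i, cutSide Z i ∈ L i := by
  simp only [(hR _).mem_iff, mem_cutSide]
  constructor
  · intro h i
    exact ⟨fun u v huv => h _ _ (blockEdge_copy_copy.2 huv), fun u hu => h _ _ (.ofSrc i u hu) hs,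
      fun u hu hu' => ht (h _ _ (.toSnk i u hu) hu')⟩
  · intro h x y hE hx
    cases hE with
    | same i u v huv => exact (h i).1 u v (Or.inl huv) hx
    | arc i u v j j' hu hv hE => exact (h i).1 u v (Or.inr ⟨j, j', hu, hv, hE⟩) hx
    | toSrc => exact hs
    | ofSrc i u hu => exact (h i).2.1 u hu
    | toSnk i u hu => exact absurd hx ((h i).2.2 u hu)
    | ofSnk => exact absurd hx ht

theorem cutCost_of_not_blockClosed {Z : Finset (CutVertex n)} (h : ¬ BlockClosed R Z) :
    (combinedNetwork R).cutCost Z = ⊤ := by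
  simp only [BlockClosed, not_forall] at h
  obtain ⟨x, y, hE, hx, hy⟩ := h
  classical
  rw [Network.cutCost]
  refine WithTop.sum_eq_top.2 ⟨(x, y), ?_, if_pos hE⟩
  simp only [Finset.mem_filter]
  exact ⟨Finset.mem_univ _, hx, hy, Or.inl hE⟩

theorem cutCost_of_blockClosed {Z : Finset (CutVertex n)} (h : BlockClosed R Z) :
    (combinedNetwork R).cutCost Z = ((symmDiff (cutSide Z 0) (cutSide Z 1)).card : ℕ∞) := by
  classical
  -- An element on one side only is sent to the one of its two link edges that leaves `Z`. These are
  -- all the leaving edges, since no block edge leaves.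
  have hinj : Set.InjOn (fun v : Fin n => if v ∈ cutSide Z 0 then (copy 0 v, copy 1 v)
      else ((copy 1 v, copy 0 v) : CutVertex n × CutVertex n))
      (symmDiff (cutSide Z 0) (cutSide Z 1) : Finset (Fin n)) := by
    intro v _ w _ hvw
    simp only [copy] at hvw
    split_ifs at hvw <;> simp_all
  rw [← Finset.card_image_of_injOn hinj, Finset.cast_card, Network.cutCost]
  refine Finset.sum_congr (Finset.ext ?_) ?_
  · rintro ⟨x, y⟩
    simp only [Finset.mem_filter, Finset.mem_univ, true_and, Finset.mem_image,
      Finset.mem_symmDiff, mem_cutSide]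
    constructor
    · rintro ⟨hx, hy, hE | hE⟩
      · exact absurd (h x y hE hx) hy
      · cases hE with
        | forth v => exact ⟨v, Or.inl ⟨hx, hy⟩, if_pos hx⟩
        | back v => exact ⟨v, Or.inr ⟨hx, hy⟩, if_neg hy⟩
    · rintro ⟨v, hv, he⟩
      rcases hv with ⟨h0, h1⟩ | ⟨h1, h0⟩
      · rw [if_pos h0, Prod.mk.injEq] at he
        obtain ⟨rfl, rfl⟩ := he
        exact ⟨h0, h1, Or.inr (.forth v)⟩
      · rw [if_neg h0, Prod.mk.injEq] at he
        obtain ⟨rfl, rfl⟩ := he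
        exact ⟨h1, h0, Or.inr (.back v)⟩
  · rintro ⟨x, y⟩ hxy
    simp only [Finset.mem_image] at hxy
    obtain ⟨v, -, he⟩ := hxy
    have : ¬ BlockEdge R x y := by
      split_ifs at he <;> obtain ⟨rfl, rfl⟩ := Prod.mk.inj he <;>
        exact not_blockEdge_of_ne (by decide) v v
    simp [combinedNetwork, this]

/-- The cut with the given sides. -/
def cutOfSides (Y : Fin 2 → Finset (Fin n)) : Finset (CutVertex n) :=
  Finset.univ.filter fun x => Sum.elim (fun a => decide (a = 0)) (fun iv => decide (iv.2 ∈ Y iv.1)) x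

theorem cutSide_cutOfSides (Y : Fin 2 → Finset (Fin n)) (i : Fin 2) :
    cutSide (cutOfSides Y) i = Y i := by
  ext v
  simp [mem_cutSide, cutOfSides, copy]

theorem isCut_cutOfSides (Y : Fin 2 → Finset (Fin n)) :
    (combinedNetwork R).IsCut (cutOfSides Y) := by
  simp [Network.IsCut, cutOfSides, combinedNetwork, src, snk]

theorem cutCost_cutOfSides {L : Fin 2 → Set (Finset (Fin n))} (hR : ∀ i, (R i).Represents (L i))
    {Y : Fin 2 → Finset (Fin n)} (hY : ∀ i, Y i ∈ L i) :
    (combinedNetwork R).cutCost (cutOfSides Y) = ((symmDiff (Y 0) (Y 1)).card : ℕ∞) := by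
  have hc := isCut_cutOfSides (R := R) Y
  rw [cutCost_of_blockClosed, cutSide_cutOfSides, cutSide_cutOfSides]
  exact (blockClosed_iff hR hc.1 hc.2).2 fun i => by rw [cutSide_cutOfSides]; exact hY i

/-- Any choice of members of the two families gives a cut of finite cost, so a minimum cut has
finite cost too. -/
theorem Network.IsMinCut.blockClosed {L : Fin 2 → Set (Finset (Fin n))}
    (hR : ∀ i, (R i).Represents (L i)) (hL : ∀ i, (L i).Nonempty) {Z : Finset (CutVertex n)}
    (hZ : (combinedNetwork R).IsMinCut Z) : BlockClosed R Z := by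
  choose Y hY using hL
  by_contra h
  have := hZ.2 _ (isCut_cutOfSides Y)
  rw [cutCost_of_not_blockClosed h, cutCost_cutOfSides hR hY] at this
  simp at this

end CombinedNetwork

/-! ### Distances between minimizers and halving -/

theorem argminSets_nonempty {V : Type} [Finite V] (f : Finset V → ℝ) :
    (argminSets f).Nonempty :=
  Finite.exists_min f

theorem card_symmDiff_triangle {V : Type} [DecidableEq V] (X Y Z : Finset V) :
    (symmDiff X Z).card ≤ (symmDiff X Y).card + (symmDiff Y Z).card :=
  (Finset.card_le_card (symmDiff_triangle X Y Z)).trans (Finset.card_union_le _ _)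

/-- If the differences have `a` and `b` elements, the two distances are at most `⌈a/2⌉ + ⌊b/2⌋` and
`⌊a/2⌋ + ⌈b/2⌉`. Rounding costs at most one half in total, and only when `a + b` is odd, hence less
than `2 * d`. -/
theorem IsHalving.card_symmDiff_le {V : Type} [DecidableEq V] {Y₁ Y₂ X : Finset V} {d : ℕ}
    (h : IsHalving Y₁ Y₂ X) (hd : (symmDiff Y₁ Y₂).card ≤ 2 * d) :
    (symmDiff X Y₁).card ≤ d ∧ (symmDiff X Y₂).card ≤ d := by
  obtain ⟨Z₁, Z₂, h1, hc1, h2, hc2, rfl⟩ := h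
  have e1 : symmDiff (Y₁ ∩ Y₂ ∪ Z₁ ∪ Z₂) Y₁ ⊆ ((Y₁ \ Y₂) \ Z₁) ∪ Z₂ := by
    intro v hv
    have a1 := @h1 v
    have a2 := @h2 v
    simp only [Finset.mem_symmDiff, Finset.mem_union, Finset.mem_inter, Finset.mem_sdiff] at *
    tauto
  have e2 : symmDiff (Y₁ ∩ Y₂ ∪ Z₁ ∪ Z₂) Y₂ ⊆ ((Y₂ \ Y₁) \ Z₂) ∪ Z₁ := by
    intro v hv
    have a1 := @h1 v
    have a2 := @h2 v
    simp only [Finset.mem_symmDiff, Finset.mem_union, Finset.mem_inter, Finset.mem_sdiff] at *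
    tauto
  have hs : (symmDiff Y₁ Y₂).card = (Y₁ \ Y₂).card + (Y₂ \ Y₁).card :=
    Finset.card_union_of_disjoint disjoint_sdiff_sdiff
  have f1 := (Finset.card_le_card e1).trans (Finset.card_union_le _ _)
  have f2 := (Finset.card_le_card e2).trans (Finset.card_union_le _ _)
  rw [Finset.card_sdiff_of_subset h1] at f1
  rw [Finset.card_sdiff_of_subset h2] at f2
  omega

theorem IsRobustSolution.exists_symmDiff_le {V : Type} [DecidableEq V] {f : Fin 2 → Finset V → ℝ}
    {d : ℕ} {X : Finset V} (h : IsRobustSolution f d X) :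
    ∃ Y : Fin 2 → Finset V, (∀ i, Y i ∈ argminSets (f i)) ∧
      (symmDiff (Y 0) (Y 1)).card ≤ 2 * d := by
  choose Y hY hd using h
  refine ⟨Y, hY, (card_symmDiff_triangle _ X _).trans ?_⟩
  rw [symmDiff_comm (Y 0) X]
  have := hd 0
  have := hd 1
  omega

theorem IsHalving.isRobustSolution {V : Type} [DecidableEq V] {f : Fin 2 → Finset V → ℝ}
    {d : ℕ} {X Y₁ Y₂ : Finset V} (h : IsHalving Y₁ Y₂ X) (h1 : Y₁ ∈ argminSets (f 0))
    (h2 : Y₂ ∈ argminSets (f 1)) (hd : (symmDiff Y₁ Y₂).card ≤ 2 * d) :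
    IsRobustSolution f d X := by
  have := h.card_symmDiff_le hd
  intro i
  match i with
  | 0 => exact ⟨Y₁, h1, this.1⟩
  | 1 => exact ⟨Y₂, h2, this.2⟩

theorem exists_isHalving {V : Type} [DecidableEq V] (Y₁ Y₂ : Finset V) :
    ∃ X, IsHalving Y₁ Y₂ X := by
  obtain ⟨Z₁, h1, hc1⟩ := Finset.exists_subset_card_eq (Nat.div_le_self (Y₁ \ Y₂).card 2)
  obtain ⟨Z₂, h2, hc2⟩ := Finset.exists_subset_card_eq (Nat.div_le_self (Y₂ \ Y₁).card 2)
  exact ⟨_, Z₁, Z₂, h1, hc1, h2, hc2, rfl⟩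

section MinCut

variable {n d : ℕ} {f : Fin 2 → Finset (Fin n) → ℝ} {R : Fin 2 → CompactRep n}
  {Z : Finset (CutVertex n)}

theorem Network.IsMinCut.cutSide_mem (hR : ∀ i, (R i).Represents (argminSets (f i)))
    (hZ : (combinedNetwork R).IsMinCut Z) (i : Fin 2) : cutSide Z i ∈ argminSets (f i) :=
  (blockClosed_iff hR hZ.1.1 hZ.1.2).1
    (hZ.blockClosed hR fun i => argminSets_nonempty (f i)) i

theorem Network.IsMinCut.cutCost_eq (hR : ∀ i, (R i).Represents (argminSets (f i)))
    (hZ : (combinedNetwork R).IsMinCut Z) :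
    (combinedNetwork R).cutCost Z = ((symmDiff (cutSide Z 0) (cutSide Z 1)).card : ℕ∞) :=
  cutCost_of_blockClosed (hZ.blockClosed hR fun i => argminSets_nonempty (f i))

/-- The lower bound holds because every pair of minimizers forms the sides of a cut whose cost is
their distance. -/
theorem Network.IsMinCut.isLeast (hR : ∀ i, (R i).Represents (argminSets (f i)))
    (hZ : (combinedNetwork R).IsMinCut Z) :
    IsLeast {c : ℕ∞ | ∃ Y₁ ∈ argminSets (f 0), ∃ Y₂ ∈ argminSets (f 1),
      c = ((symmDiff Y₁ Y₂).card : ℕ∞)} ((combinedNetwork R).cutCost Z) := by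
  refine ⟨⟨_, hZ.cutSide_mem hR 0, _, hZ.cutSide_mem hR 1, hZ.cutCost_eq hR⟩, ?_⟩
  rintro c ⟨Y₁, h1, Y₂, h2, rfl⟩
  have hY : ∀ i, (![Y₁, Y₂] : Fin 2 → Finset (Fin n)) i ∈ argminSets (f i) :=
    Fin.forall_fin_two.2 ⟨h1, h2⟩
  simpa [cutCost_cutOfSides hR hY] using hZ.2 _ (isCut_cutOfSides ![Y₁, Y₂])

theorem Network.IsMinCut.isRobustSolution (hR : ∀ i, (R i).Represents (argminSets (f i)))
    (hZ : (combinedNetwork R).IsMinCut Z)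
    (hd : (combinedNetwork R).cutCost Z ≤ ((2 * d : ℕ) : ℕ∞)) {X : Finset (Fin n)}
    (hX : IsHalving (cutSide Z 0) (cutSide Z 1) X) : IsRobustSolution f d X := by
  rw [hZ.cutCost_eq hR, Nat.cast_le] at hd
  exact hX.isRobustSolution (hZ.cutSide_mem hR 0) (hZ.cutSide_mem hR 1) hd

theorem Network.IsMinCut.le_iff (hR : ∀ i, (R i).Represents (argminSets (f i)))
    (hZ : (combinedNetwork R).IsMinCut Z) :
    (combinedNetwork R).cutCost Z ≤ ((2 * d : ℕ) : ℕ∞) ↔ ∃ X, IsRobustSolution f d X := by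
  constructor
  · intro h
    obtain ⟨X, hX⟩ := exists_isHalving (cutSide Z 0) (cutSide Z 1)
    exact ⟨X, hZ.isRobustSolution hR h hX⟩
  · rintro ⟨X, hX⟩
    obtain ⟨Y, hY, hd⟩ := hX.exists_symmDiff_le
    exact ((hZ.isLeast hR).2 ⟨_, hY 0, _, hY 1, rfl⟩).trans (Nat.cast_le.2 hd)

end MinCut

/-! ## Turning a minimum cut into a solution -/

namespace RAMProg

/-- One pass over the ground set: the characteristic vector in array `7` of a cut is turned into
the one of a halving in array `9`, where the registers `5` and `6` tell whether the number of the
elements seen so far in the two differences is odd, and register `4` counts these elements. -/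
def halveBody : RAMProg :=
  block [sub 7 7 1, add 8 7 3, load 9 7 8, add 8 8 2, load 10 7 8,
    ite 9
      (ite 10 (store 9 7 1) (block [add 4 4 1, store 9 7 5, sub 5 1 5]))
      (ite 10 (block [add 4 4 1, store 9 7 6, sub 6 1 6]) (store 9 7 0))]

/-- The program that turns a minimum cut of the combined network into the answer. -/
def finish : RAMProg :=
  seq (block [const 0 0, const 1 1, load 2 0 0, const 3 2, const 4 0, const 5 0, const 6 0,
    add 7 2 0])
  (seq (loop 7 halveBody)
    (block [load 8 0 1, add 8 8 8, sub 8 4 8, ite 8 (store 8 0 0) (store 8 0 1)]))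

end RAMProg

/-! ### Choosing every second element of a set -/

namespace Finset

variable {n : ℕ}

/-- The elements of `A` from `j` on. -/
def fromIndex (A : Finset (Fin n)) (j : ℕ) : Finset (Fin n) := A.filter fun v => j ≤ (v : ℕ)

theorem fromIndex_zero (A : Finset (Fin n)) : A.fromIndex 0 = A := by simp [fromIndex]

theorem fromIndex_self (A : Finset (Fin n)) : A.fromIndex n = ∅ := by
  ext v
  simp [fromIndex]

theorem fromIndex_of_notMem {A : Finset (Fin n)} {w : Fin n} (hw : w ∉ A) :
    A.fromIndex w = A.fromIndex (w + 1) := by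
  ext v
  simp only [fromIndex, mem_filter, and_congr_right_iff]
  intro hv
  have : (v : ℕ) ≠ w := fun h => hw (Fin.ext h ▸ hv)
  omega

theorem fromIndex_of_mem {A : Finset (Fin n)} {w : Fin n} (hw : w ∈ A) :
    A.fromIndex w = insert w (A.fromIndex (w + 1)) := by
  ext v
  simp only [fromIndex, mem_filter, mem_insert]
  constructor
  · rintro ⟨hv, h⟩
    rcases h.eq_or_lt with h | h
    · exact Or.inl (Fin.ext h.symm)
    · exact Or.inr ⟨hv, h⟩
  · rintro (rfl | ⟨hv, h⟩)
    · exact ⟨hw, le_rfl⟩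
    · exact ⟨hv, by omega⟩

theorem notMem_fromIndex_succ (A : Finset (Fin n)) (w : Fin n) : w ∉ A.fromIndex (w + 1) := by
  simp [fromIndex]

/-- `Z` contains half of the elements of `A` from `j` on, and `t` is the remainder. -/
structure IsHalf (A : Finset (Fin n)) (j t : ℕ) (Z : Finset (Fin n)) : Prop where
  subset : Z ⊆ A.fromIndex j
  card : 2 * Z.card + t = (A.fromIndex j).card
  le_one : t ≤ 1

theorem IsHalf.of_notMem {A Z : Finset (Fin n)} {w : Fin n} {t : ℕ} (h : A.IsHalf (w + 1) t Z)
    (hw : w ∉ A) : A.IsHalf w t Z := by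
  exact ⟨fromIndex_of_notMem hw ▸ h.subset, fromIndex_of_notMem hw ▸ h.card, h.le_one⟩

/-- Elements are paired in the order of the pass. The new element is chosen exactly when an unpaired
one is waiting, that is, when `t = 1`, and the remainder flips. -/
theorem IsHalf.exists_of_mem {A Z : Finset (Fin n)} {w : Fin n} {t : ℕ}
    (h : A.IsHalf (w + 1) t Z) (hw : w ∈ A) :
    ∃ Z', A.IsHalf w (1 - t) Z' ∧ ∀ v, v ∈ Z' ↔ v ∈ Z ∨ v = w ∧ t = 1 := by
  have hc := card_insert_of_notMem (notMem_fromIndex_succ A w)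
  have hz : w ∉ Z := fun hz => notMem_fromIndex_succ A w (h.subset hz)
  have h2 := h.card
  rcases Nat.le_one_iff_eq_zero_or_eq_one.1 h.le_one with rfl | rfl
  · refine ⟨Z, ⟨?_, ?_, by omega⟩, by simp⟩ <;> rw [fromIndex_of_mem hw]
    · exact h.subset.trans (subset_insert _ _)
    · omega
  · refine ⟨insert w Z, ⟨?_, ?_, by omega⟩, by simp [or_comm]⟩ <;> rw [fromIndex_of_mem hw]
    · exact insert_subset_insert _ h.subset
    · rw [hc, card_insert_of_notMem hz]
      omega

end Finset

/-- The invariant of the pass over the ground set. -/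
structure HalveInv {n : ℕ} (Y₁ Y₂ : Finset (Fin n)) (j : ℕ) (τ : RAMState)
    (Z₁ Z₂ : Finset (Fin n)) : Prop where
  half₁ : (Y₁ \ Y₂).IsHalf j (τ.reg 5) Z₁
  half₂ : (Y₂ \ Y₁).IsHalf j (τ.reg 6) Z₂
  count : τ.reg 4 = ((Y₁ \ Y₂).fromIndex j).card + ((Y₂ \ Y₁).fromIndex j).card
  arr : ∀ v : Fin n, j ≤ v → τ.arr 9 v = if v ∈ Y₁ ∩ Y₂ ∪ Z₁ ∪ Z₂ then 1 else 0

theorem haltsWithin_halveBody {n : ℕ} {Y₁ Y₂ Z₁ Z₂ : Finset (Fin n)} {w : Fin n} {τ : RAMState}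
    (h : HalveInv Y₁ Y₂ (w + 1) τ Z₁ Z₂) (h0 : τ.reg 0 = 0) (h1 : τ.reg 1 = 1) (h2 : τ.reg 2 = n)
    (h3 : τ.reg 3 = 2) (h7 : τ.reg 7 = w + 1)
    (hY₁ : τ.arr 7 (2 + w) = if w ∈ Y₁ then 1 else 0)
    (hY₂ : τ.arr 7 (2 + (w + n)) = if w ∈ Y₂ then 1 else 0) :
    HaltsWithin RAMProg.halveBody τ 11 fun υ =>
      (∃ Z₁ Z₂, HalveInv Y₁ Y₂ w υ Z₁ Z₂) ∧ υ.reg 7 = w := by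
  refine (HaltsWithin.of_wp ?_).mono (by simp [RAMProg.halveBody, RAMProg.block, RAMProg.time])
    fun _ => id
  have e1 : (w : ℕ) + 2 = 2 + w := by omega
  have e2 : 2 + (w : ℕ) + n = 2 + (w + n) := by omega
  have hc₁ := Finset.card_insert_of_notMem (Finset.notMem_fromIndex_succ (Y₁ \ Y₂) w)
  have hc₂ := Finset.card_insert_of_notMem (Finset.notMem_fromIndex_succ (Y₂ \ Y₁) w)
  have hz₁ : w ∉ Z₁ := fun hz => Finset.notMem_fromIndex_succ _ w (h.half₁.subset hz)
  have hz₂ : w ∉ Z₂ := fun hz => Finset.notMem_fromIndex_succ _ w (h.half₂.subset hz)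
  have harr := h.arr
  have hlt : ∀ v : Fin n, (w : ℕ) ≤ v → v ≠ w → (w : ℕ) + 1 ≤ v := fun v hv hne => by
    have : (v : ℕ) ≠ w := fun h => hne (Fin.ext h)
    omega
  simp only [RAMProg.halveBody, RAMProg.block, RAMProg.wp]
  simp [h0, h1, h2, h3, h7, e1, e2, hY₁, hY₂]
  -- The cases are: `w` in both sets, only in `Y₁`, only in `Y₂`, in neither. In the mixed cases the
  -- stored value is the parity bit before its flip, as `IsHalf.exists_of_mem` demands.
  refine ⟨fun m1 => ⟨fun m2 => ?_, fun m2 => ?_⟩, fun m1 => ⟨fun m2 => ?_, fun m2 => ?_⟩⟩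
  · have n1 : w ∉ Y₁ \ Y₂ := by simp [m2]
    have n2 : w ∉ Y₂ \ Y₁ := by simp [m1]
    refine ⟨Z₁, Z₂, h.half₁.of_notMem n1, h.half₂.of_notMem n2, ?_, fun v hv => ?_⟩
    · simpa [Finset.fromIndex_of_notMem n1, Finset.fromIndex_of_notMem n2] using h.count
    · rw [RAMState.arr_setArr_self]
      rcases eq_or_ne v w with rfl | hne
      · simp [m1, m2]
      · simp [Fin.val_inj, hne, harr v (hlt v hv hne)]
  · have n1 : w ∈ Y₁ \ Y₂ := by simp [m1, m2]
    have n2 : w ∉ Y₂ \ Y₁ := by simp [m1]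
    obtain ⟨Z', hZ', hmem⟩ := h.half₁.exists_of_mem n1
    refine ⟨Z', Z₂, by simpa using hZ', h.half₂.of_notMem n2, ?_, fun v hv => ?_⟩
    · have := h.count
      simp [Finset.fromIndex_of_mem n1, Finset.fromIndex_of_notMem n2]
      omega
    · rw [RAMState.arr_setReg, RAMState.arr_setArr_self]
      rcases eq_or_ne v w with rfl | hne
      · have := h.half₁.le_one
        simp [m2, hmem, hz₁, hz₂]
        split_ifs <;> omega
      · simp [Fin.val_inj, hne, hmem, harr v (hlt v hv hne)]
  · have n1 : w ∉ Y₁ \ Y₂ := by simp [m2]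
    have n2 : w ∈ Y₂ \ Y₁ := by simp [m1, m2]
    obtain ⟨Z', hZ', hmem⟩ := h.half₂.exists_of_mem n2
    refine ⟨Z₁, Z', h.half₁.of_notMem n1, by simpa using hZ', ?_, fun v hv => ?_⟩
    · have := h.count
      simp [Finset.fromIndex_of_mem n2, Finset.fromIndex_of_notMem n1]
      omega
    · rw [RAMState.arr_setReg, RAMState.arr_setArr_self]
      rcases eq_or_ne v w with rfl | hne
      · have := h.half₂.le_one
        simp [m1, hmem, hz₁, hz₂]
        split_ifs <;> omega
      · simp [Fin.val_inj, hne, hmem, harr v (hlt v hv hne)]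
  · have n1 : w ∉ Y₁ \ Y₂ := by simp [m1]
    have n2 : w ∉ Y₂ \ Y₁ := by simp [m2]
    refine ⟨Z₁, Z₂, h.half₁.of_notMem n1, h.half₂.of_notMem n2, ?_, fun v hv => ?_⟩
    · simpa [Finset.fromIndex_of_notMem n1, Finset.fromIndex_of_notMem n2] using h.count
    · rw [RAMState.arr_setArr_self]
      rcases eq_or_ne v w with rfl | hne
      · simp [m1, hz₁, hz₂]
      · simp [Fin.val_inj, hne, harr v (hlt v hv hne)]

theorem numbering_copy {n : ℕ} (i : Fin 2) (v : Fin n) :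
    (CutVertex.numbering n (CutVertex.copy i v) : ℕ) = 2 + (v + n * i) := by
  simp [CutVertex.numbering, CutVertex.copy]

/-- This exchanges the classical decidability instance of the definition for the given one. -/
theorem holdsSet_iff {W : Type} [DecidableEq W] {m a : ℕ} {e : W ≃ Fin m} {Z : Finset W}
    {σ : RAMState} :
    HoldsSet e Z a σ ↔ ∀ x, σ.arr a (e x : ℕ) = if x ∈ Z then 1 else 0 := by
  unfold HoldsSet
  exact forall_congr' fun x => by split_ifs <;> rfl

theorem HoldsSet.arr_copy {n a : ℕ} {Z : Finset (CutVertex n)} {σ : RAMState}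
    (h : HoldsSet (CutVertex.numbering n) Z a σ) (i : Fin 2) (v : Fin n) :
    σ.arr a (2 + (v + n * i)) = if v ∈ cutSide Z i then 1 else 0 := by
  rw [← numbering_copy, holdsSet_iff.1 h]
  exact if_congr mem_cutSide.symm rfl rfl

theorem haltsWithin_finish {n d : ℕ} {Z : Finset (CutVertex n)} {σ : RAMState}
    (hn : σ.arr 0 0 = n) (hd : σ.arr 0 1 = d) (hZ : HoldsSet (CutVertex.numbering n) Z 7 σ) :
    HaltsWithin RAMProg.finish σ (12 * n + 15) fun τ =>
      ((symmDiff (cutSide Z 0) (cutSide Z 1)).card ≤ 2 * d ∧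
        ∃ X, IsHalving (cutSide Z 0) (cutSide Z 1) X ∧ AnswersYes X τ) ∨
      (¬ (symmDiff (cutSide Z 0) (cutSide Z 1)).card ≤ 2 * d ∧ AnswersNo τ) := by
  set Y₁ := cutSide Z 0 with hY₁
  set Y₂ := cutSide Z 1 with hY₂
  have hs : (symmDiff Y₁ Y₂).card = (Y₁ \ Y₂).card + (Y₂ \ Y₁).card :=
    Finset.card_union_of_disjoint disjoint_sdiff_sdiff
  have hm₁ : ∀ w : Fin n, σ.arr 7 (2 + w) = if w ∈ Y₁ then 1 else 0 := fun w => by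
    simpa using hZ.arr_copy 0 w
  have hm₂ : ∀ w : Fin n, σ.arr 7 (2 + (w + n)) = if w ∈ Y₂ then 1 else 0 := fun w => by
    simpa using hZ.arr_copy 1 w
  refine (HaltsWithin.wp_seq (T := n * 12 + 1 + 6) ?_).mono (by
    simp only [RAMProg.block, RAMProg.time]; omega) fun _ => id
  simp only [RAMProg.block, RAMProg.wp]
  refine HaltsWithin.seq ?_
  refine (HaltsWithin.for_loop (T := 11) (n := n)
    (fun j τ => ∃ Z₁ Z₂, HalveInv Y₁ Y₂ j τ Z₁ Z₂) (by simp [hn]) ?_ ?_).frame.mono le_rfl ?_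
  · refine ⟨∅, ∅, ⟨by simp, ?_, ?_⟩, ⟨by simp, ?_, ?_⟩, ?_, fun v hv => absurd v.2 (by omega)⟩ <;>
      simp [Finset.fromIndex_self]
  · rintro j τ ⟨Z₁, Z₂, hI⟩ hj hlt hf
    have f0 := hf.reg 0 (by decide)
    have f1 := hf.reg 1 (by decide)
    have f2 := hf.reg 2 (by decide)
    have f3 := hf.reg 3 (by decide)
    have f7 := hf.arr 7 (by decide)
    refine haltsWithin_halveBody (w := ⟨j, hlt⟩) hI ?_ ?_ ?_ ?_ hj ?_ ?_
    · simpa using f0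
    · simpa using f1
    · simpa [hn] using f2
    · simpa using f3
    · rw [f7]; exact hm₁ ⟨j, hlt⟩
    · rw [f7]; exact hm₂ ⟨j, hlt⟩
  · rintro τ ⟨⟨Z₁, Z₂, hI⟩, hf⟩
    have f0 : τ.reg 0 = 0 := by simpa using hf.reg 0 (by decide)
    have f1 : τ.reg 1 = 1 := by simpa using hf.reg 1 (by decide)
    have f2 : τ.arr 0 1 = d := by simpa [hd] using congrFun (hf.arr 0 (by decide)) 1
    have hcount := hI.count
    have c₁ := hI.half₁.card
    have c₂ := hI.half₂.card
    have s₁ := hI.half₁.subset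
    have s₂ := hI.half₂.subset
    have l₁ := hI.half₁.le_one
    have l₂ := hI.half₂.le_one
    simp only [Finset.fromIndex_zero] at hcount c₁ c₂ s₁ s₂
    refine (HaltsWithin.of_wp ?_).mono (by simp [RAMProg.time]) fun _ => id
    simp only [RAMProg.wp]
    simp [f0, f1, f2]
    -- The tested register holds the truncated difference of the distance and `2 * d`, which is
    -- nonzero exactly if the distance is too large. The cardinalities are floors because `2 *
    -- Z.card + t` is the full size with `t ≤ 1`.
    refine ⟨fun h => Or.inr ⟨by omega, by simp [AnswersNo, RAMState.arr_setArr_self]⟩,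
      fun h => Or.inl ⟨by omega, _, ⟨Z₁, Z₂, s₁, by omega, s₂, by omega, rfl⟩,
        by simp [RAMState.arr_setArr_self],
        holdsSet_iff.2 fun v => ?_⟩⟩
    simpa using hI.arr v (Nat.zero_le _)

/-! ## Constructing the combined network -/

/-- As a rewrite rule this moves register updates outwards, where statements about arrays ignore
them. -/
theorem RAMState.setArr_setReg (σ : RAMState) (x v a i w : ℕ) :
    (σ.setReg x v).setArr a i w = (σ.setArr a i w).setReg x v := rfl

open Classical in
/-- The entry of the cost matrix of a network with costs in `{1, ∞}`. -/
noncomputable def Network.entry {W : Type} (N : Network W) (x y : W) : ℕ :=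
  if N.Adj x y then (if N.cost x y = ⊤ then 2 else 1) else 0

namespace RAMProg

/-- `reg 13` receives the entry for two elements of the same layer, whose block labels are in the
registers `9` and `12`. Register `24` holds `b + 1`, register `25` holds `(b + 1) * reg 9` and
register `15` holds `b + 1 - reg 9`. -/
def linkValue (aE : ℕ) : RAMProg :=
  block [const 13 0, sub 14 9 12, sub 16 12 9, add 14 14 16, sub 16 24 12,
    ite 14
      (ite 15 (ite 16 (block [add 17 25 12, load 17 aE 17, add 13 17 17]) (const 14 0))
        (const 14 0))
      (const 13 2)]

/-- `reg 13` receives the entry for the elements `reg 8` and `reg 11` of different layers. -/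
def diagValue : RAMProg :=
  block [sub 14 8 11, sub 16 11 8, add 14 14 16, ite 14 (const 13 0) (const 13 1)]

/-- The entries in two columns of a row, where register `22` holds the start of the row, and the
registers `7` and `23` hold the starts of the own layer and of the other layer. -/
def colBody (aB aE : ℕ) : RAMProg :=
  seq (block [sub 11 11 1, load 12 aB 11])
    (seq (linkValue aE)
      (seq (block [add 17 22 7, add 17 17 11, store 6 17 13])
        (seq diagValue (block [add 17 22 23, add 17 17 11, store 6 17 13]))))

/-- The entries for the terminals and an element with row `reg 10` and block label `reg 9`. -/
def terminalEntries : RAMProg :=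
  block [add 22 20 0, ite 9 (const 13 0) (const 13 2), store 6 22 13, store 6 10 13, sub 15 24 9,
    ite 15 (const 13 0) (const 13 2), add 14 22 1, store 6 14 13, add 14 3 10, store 6 14 13]

/-- The entries in the row of an element, and in the rows of the terminals in its column. -/
def rowBody (aB aE : ℕ) : RAMProg :=
  seq (block [sub 8 8 1, load 9 aB 8, add 10 7 8])
    (seq (mul 10 3)
      (seq terminalEntries
        (seq (mul 9 24) (seq (block [add 25 20 0, add 11 2 0]) (loop 11 (colBody aB aE))))))

/-- The rows of one layer. Register `rb` holds the number `b` of its blocks, and the registers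
`o` and `o'` hold the starts of the own layer and of the other layer. -/
def layer (aB aE rb o o' : ℕ) : RAMProg :=
  seq (block [add 7 o 0, add 23 o' 0, add 24 rb 1, add 8 2 0]) (loop 8 (rowBody aB aE))

/-- The program that constructs the combined network. -/
def build : RAMProg :=
  seq (block [const 0 0, const 1 1, const 18 2, const 19 3, load 2 0 0, load 4 0 18, load 5 0 19,
    add 19 2 18, add 3 19 2, store 5 0 3, store 5 1 0, store 5 18 1,
    store 6 0 0, store 6 1 0, store 6 3 0, add 17 3 1, store 6 17 0])
    (seq (layer 1 2 4 18 19) (layer 3 4 5 19 18))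

end RAMProg

/-! ### Entries of the cost matrix and the passes that write them -/

section Build

open CutVertex

variable {n : ℕ} {R : Fin 2 → CompactRep n}

open Classical in
theorem entry_copy_copy_same (i : Fin 2) (u v : Fin n) :
    (combinedNetwork R).entry (copy i u) (copy i v) = if (R i).Linked u v then 2 else 0 := by
  simp only [Network.entry, combinedNetwork, blockEdge_copy_copy, linkEdge_copy_copy]
  split_ifs <;> simp_all

theorem entry_copy_copy_of_ne {i i' : Fin 2} (h : i ≠ i') (u v : Fin n) :
    (combinedNetwork R).entry (copy i u) (copy i' v) = if u = v then 1 else 0 := by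
  simp [Network.entry, combinedNetwork, not_blockEdge_of_ne h, linkEdge_copy_copy, h]

theorem entry_inl_inl (a b : Fin 2) : (combinedNetwork R).entry (Sum.inl a) (Sum.inl b) = 0 := by
  simp [Network.entry, combinedNetwork, not_blockEdge_inl, not_linkEdge_inl_left]

theorem entry_of_not_linkEdge {x y : CutVertex n} {p : Prop} [Decidable p]
    (h : ¬ LinkEdge x y) (hp : BlockEdge R x y ↔ p) :
    (combinedNetwork R).entry x y = if p then 2 else 0 := by
  simp only [Network.entry, combinedNetwork, h, or_false, hp]
  split_ifs <;> simp_all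

theorem block_eq_zero_iff (Rᵢ : CompactRep n) (u : Fin n) :
    Rᵢ.block u = 0 ↔ (Rᵢ.block u : ℕ) = 0 := by
  rw [Fin.ext_iff, Fin.val_zero]

theorem block_eq_last_iff (Rᵢ : CompactRep n) (u : Fin n) :
    Rᵢ.block u = Fin.last (Rᵢ.b + 1) ↔ Rᵢ.b + 1 - (Rᵢ.block u : ℕ) = 0 := by
  rw [Fin.ext_iff, Fin.val_last]
  omega

theorem entry_src_copy (i : Fin 2) (u : Fin n) :
    (combinedNetwork R).entry src (copy i u) = if ((R i).block u : ℕ) = 0 then 2 else 0 :=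
  entry_of_not_linkEdge (not_linkEdge_inl_left _ _)
    (blockEdge_src_copy.trans (block_eq_zero_iff _ _))

theorem entry_copy_src (i : Fin 2) (u : Fin n) :
    (combinedNetwork R).entry (copy i u) src = if ((R i).block u : ℕ) = 0 then 2 else 0 :=
  entry_of_not_linkEdge (not_linkEdge_inl_right _ _)
    (blockEdge_copy_src.trans (block_eq_zero_iff _ _))

theorem entry_snk_copy (i : Fin 2) (u : Fin n) :
    (combinedNetwork R).entry snk (copy i u) =
      if (R i).b + 1 - ((R i).block u : ℕ) = 0 then 2 else 0 :=
  entry_of_not_linkEdge (not_linkEdge_inl_left _ _)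
    (blockEdge_snk_copy.trans (block_eq_last_iff _ _))

theorem entry_copy_snk (i : Fin 2) (u : Fin n) :
    (combinedNetwork R).entry (copy i u) snk =
      if (R i).b + 1 - ((R i).block u : ℕ) = 0 then 2 else 0 :=
  entry_of_not_linkEdge (not_linkEdge_inl_right _ _)
    (blockEdge_copy_snk.trans (block_eq_last_iff _ _))

theorem Nat.mul_add_inj {m x y x' y' : ℕ} (hy : y < m) (hy' : y' < m)
    (h : x * m + y = x' * m + y') : x = x' ∧ y = y' := by
  have h1 := congrArg (· / m) h
  have h2 := congrArg (· % m) h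
  have hm : 0 < m := by omega
  simp only [mul_comm _ m, Nat.mul_add_div hm, Nat.mul_add_mod, Nat.div_eq_of_lt hy,
    Nat.div_eq_of_lt hy', Nat.mod_eq_of_lt hy, Nat.mod_eq_of_lt hy'] at h1 h2
  omega

/-- Array `6` holds the entries of the combined network in the places `D`. -/
def Written (R : Fin 2 → CompactRep n) (D : CutVertex n → CutVertex n → Prop) (σ : RAMState) :
    Prop :=
  ∀ x y, D x y → σ.arr 6 ((numbering n x : ℕ) * (2 + 2 * n) + numbering n y) =
    (combinedNetwork R).entry x y

theorem written_setReg {D : CutVertex n → CutVertex n → Prop} {σ : RAMState} {x v : ℕ} :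
    Written R D (σ.setReg x v) ↔ Written R D σ := Iff.rfl

theorem Written.mono {D D' : CutVertex n → CutVertex n → Prop} {σ : RAMState}
    (h : Written R D σ) (hD : ∀ x y, D' x y → D x y) : Written R D' σ :=
  fun x y hxy => h x y (hD x y hxy)

/-- Distinct pairs have distinct addresses, so a correct entry never damages another one. -/
theorem Written.store {D : CutVertex n → CutVertex n → Prop} {σ : RAMState} (h : Written R D σ)
    (x y : CutVertex n) {k w : ℕ}
    (hk : k = (numbering n x : ℕ) * (2 + 2 * n) + numbering n y)
    (hw : w = (combinedNetwork R).entry x y) :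
    Written R (fun x' y' => D x' y' ∨ x' = x ∧ y' = y) (σ.setArr 6 k w) := by
  intro x' y' hD
  rw [RAMState.arr_setArr_self]
  split_ifs with he
  · obtain ⟨h1, h2⟩ := Nat.mul_add_inj (numbering n y').2 (numbering n y).2 (he.trans hk)
    rw [(numbering n).injective (Fin.ext h1), (numbering n).injective (Fin.ext h2), hw]
  · refine h x' y' (hD.resolve_right ?_)
    rintro ⟨rfl, rfl⟩
    exact he hk.symm

theorem haltsWithin_linkValue {Rᵢ : CompactRep n} {u v : Fin n} {τ : RAMState} {aB aE : ℕ}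
    (hrep : HoldsRep Rᵢ aB aE τ) (h9 : τ.reg 9 = Rᵢ.block u) (h12 : τ.reg 12 = Rᵢ.block v)
    (h15 : τ.reg 15 = Rᵢ.b + 1 - Rᵢ.block u) (h24 : τ.reg 24 = Rᵢ.b + 1)
    (h25 : τ.reg 25 = (Rᵢ.block u : ℕ) * (Rᵢ.b + 1)) :
    HaltsWithin (RAMProg.linkValue aE) τ 11 fun υ =>
      (Rᵢ.Linked u v → υ.reg 13 = 2) ∧ (¬ Rᵢ.Linked u v → υ.reg 13 = 0) := by
  classical
  refine (HaltsWithin.of_wp ?_).mono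
    (by simp [RAMProg.linkValue, RAMProg.block, RAMProg.time]) fun _ => id
  simp only [RAMProg.linkValue, RAMProg.block, RAMProg.wp]
  simp [h9, h12, h15, h24, h25]
  -- The truncated difference vanishes exactly for the label `∞`, which has no row or column in the
  -- adjacency matrix.
  have hnot : ∀ w : Fin n, Rᵢ.b + 1 - (Rᵢ.block w : ℕ) = 0 → ∀ j : Fin (Rᵢ.b + 1),
      Rᵢ.block w ≠ j.castSucc := fun w hw j hj => by
    rw [hj, Fin.val_castSucc] at hw
    omega
  have hcast : ∀ w : Fin n, ¬ Rᵢ.b + 1 - (Rᵢ.block w : ℕ) = 0 → ∃ j : Fin (Rᵢ.b + 1),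
      Rᵢ.block w = j.castSucc := fun w hw => ⟨⟨Rᵢ.block w, by omega⟩, rfl⟩
  refine ⟨fun h => ?_, fun h h' => ?_⟩
  · have hne : (Rᵢ.block u : ℕ) ≠ Rᵢ.block v := by omega
    refine ⟨fun hu => ⟨fun hv => ?_, fun hv => ?_⟩, fun hu => ?_⟩
    · obtain ⟨j, hj⟩ := hcast u hu
      obtain ⟨j', hj'⟩ := hcast v hv
      have harr := hrep.2 j j'
      rw [hj, hj', Fin.val_castSucc, Fin.val_castSucc] at hne
      rw [hj, hj', Fin.val_castSucc, Fin.val_castSucc, harr]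
      have : Rᵢ.Linked u v ↔ Rᵢ.edge j j' := by
        refine ⟨?_, fun h => Or.inr ⟨j, j', hj, hj', h⟩⟩
        rintro (h | ⟨k, k', hk, hk', h⟩)
        · exact absurd (Fin.ext_iff.1 (hj.symm.trans (h.trans hj'))) hne
        · rwa [Fin.castSucc_injective _ (hj.symm.trans hk),
            Fin.castSucc_injective _ (hj'.symm.trans hk')]
      rw [this]
      split_ifs <;> simp_all
    · rintro (h | ⟨k, k', hk, hk', h⟩)
      · exact hne (congrArg Fin.val h)
      · exact hnot v hv k' hk'
    · rintro (h | ⟨k, k', hk, hk', h⟩)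
      · exact hne (congrArg Fin.val h)
      · exact hnot u hu k hk
  · exact Or.inl (Fin.ext (by omega))
/-- The registers while the row of `copy i u` is written. -/
structure RowRegs (Rᵢ : CompactRep n) (i i' : Fin 2) (u : Fin n) (τ : RAMState) : Prop where
  reg1 : τ.reg 1 = 1
  reg7 : τ.reg 7 = 2 + n * i
  reg8 : τ.reg 8 = u
  reg9 : τ.reg 9 = Rᵢ.block u
  reg15 : τ.reg 15 = Rᵢ.b + 1 - Rᵢ.block u
  reg22 : τ.reg 22 = (2 + (u + n * i)) * (2 + 2 * n)
  reg23 : τ.reg 23 = 2 + n * i'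
  reg24 : τ.reg 24 = Rᵢ.b + 1
  reg25 : τ.reg 25 = (Rᵢ.block u : ℕ) * (Rᵢ.b + 1)

theorem HoldsRep.congr {Rᵢ : CompactRep n} {aB aE : ℕ} {σ τ : RAMState}
    (h : HoldsRep Rᵢ aB aE σ) (hB : τ.arr aB = σ.arr aB) (hE : τ.arr aE = σ.arr aE) :
    HoldsRep Rᵢ aB aE τ := by
  unfold HoldsRep
  rw [hB, hE]
  exact h

theorem haltsWithin_colBody {i i' : Fin 2} (hi : i ≠ i') {u v : Fin n} {τ : RAMState}
    {aB aE : ℕ} {D : CutVertex n → CutVertex n → Prop} (hrep : HoldsRep (R i) aB aE τ)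
    (hregs : RowRegs (R i) i i' u τ) (h11 : τ.reg 11 = v + 1) (hW : Written R D τ) :
    HaltsWithin (RAMProg.colBody aB aE) τ 24 fun υ =>
      Written R (fun x y => D x y ∨ x = copy i u ∧ ∃ k, y = copy k v) υ ∧ υ.reg 11 = v := by
  classical
  refine (HaltsWithin.wp_seq (T := 11 + (3 + (5 + 3))) ?_).mono
    (by simp [RAMProg.block, RAMProg.time]) fun _ => id
  obtain ⟨r1, r7, r8, r9, r15, r22, r23, r24, r25⟩ := hregs
  simp only [RAMProg.block, RAMProg.wp]
  simp only [RAMState.reg_setReg_self, RAMState.arr_setReg, h11, r1, Nat.add_sub_cancel, hrep.1]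
  have hlink := haltsWithin_linkValue (Rᵢ := R i) (u := u) (v := v) (aB := aB) (aE := aE)
    (τ := (τ.setReg 11 v).setReg 12 ((R i).block v))
    (hrep.congr rfl rfl) (by simpa) (by simp) (by simpa) (by simpa) (by simpa)
  refine HaltsWithin.seq (hlink.frame.mono le_rfl ?_)
  rintro τ₁ ⟨hval, hf⟩
  -- What the program may change does not depend on `aE`, which it only reads. With a numeral in its
  -- place, `decide` can evaluate the lists.
  replace hf : (RAMProg.linkValue 0).Frame _ τ₁ := ⟨hf.reg, hf.arr⟩
  have hval : τ₁.reg 13 = (combinedNetwork R).entry (copy i u) (copy i v) := by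
    rw [entry_copy_copy_same]
    split_ifs with h
    exacts [hval.1 h, hval.2 h]
  have f7 : τ₁.reg 7 = 2 + n * i := (hf.reg 7 (by decide)).trans (by simpa)
  have f8 : τ₁.reg 8 = u := (hf.reg 8 (by decide)).trans (by simpa)
  have f11 : τ₁.reg 11 = v := (hf.reg 11 (by decide)).trans (by simp)
  have f22 : τ₁.reg 22 = _ := (hf.reg 22 (by decide)).trans (by simpa)
  have f23 : τ₁.reg 23 = 2 + n * i' := (hf.reg 23 (by decide)).trans (by simpa)
  have fW : Written R D τ₁ := by
    unfold Written
    rw [hf.arr 6 (by decide)]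
    exact hW
  have hk : τ₁.reg 22 + τ₁.reg 7 + τ₁.reg 11 =
      (numbering n (copy i u) : ℕ) * (2 + 2 * n) + numbering n (copy i v) := by
    rw [f7, f11, f22, numbering_copy, numbering_copy]
    ring
  have hk' : τ₁.reg 22 + τ₁.reg 23 + τ₁.reg 11 =
      (numbering n (copy i u) : ℕ) * (2 + 2 * n) + numbering n (copy i' v) := by
    rw [f23, f11, f22, numbering_copy, numbering_copy]
    ring
  refine (HaltsWithin.of_wp ?_).mono (by simp [RAMProg.diagValue, RAMProg.block, RAMProg.time])
    fun _ => id
  have hW₁ := fW.store _ _ hk hval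
  have huv : τ₁.reg 8 - τ₁.reg 11 + (τ₁.reg 11 - τ₁.reg 8) = 0 ↔ u = v := by
    rw [f8, f11, Fin.ext_iff]
    omega
  have hlast : ∀ w : ℕ, w = (if u = v then 1 else 0) → Written R
      (fun x y => D x y ∨ x = copy i u ∧ ∃ k, y = copy k v)
      ((τ₁.setArr 6 (τ₁.reg 22 + τ₁.reg 7 + τ₁.reg 11) (τ₁.reg 13)).setArr 6
        (τ₁.reg 22 + τ₁.reg 23 + τ₁.reg 11) w) := by
    intro w hw
    rw [← entry_copy_copy_of_ne hi u v] at hw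
    refine (hW₁.store _ _ hk' hw).mono ?_
    rintro x y (h | ⟨rfl, k, rfl⟩)
    · exact Or.inl (Or.inl h)
    · by_cases hki : k = i
      · exact Or.inl (Or.inr ⟨rfl, by rw [hki]⟩)
      · exact Or.inr ⟨rfl, by rw [show k = i' by omega]⟩
  simp only [RAMProg.diagValue, RAMProg.block, RAMProg.wp, RAMState.setArr_setReg]
  simp only [f8, f11] at huv hlast
  simp [f8, f11, written_setReg, -Fin.exists_fin_two]
  refine ⟨fun h => hlast 0 ?_, fun h h' => hlast 1 ?_⟩
  · rw [if_neg fun huv' => by have := huv.2 huv'; omega]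
  · rw [if_pos (huv.1 (by omega))]

theorem haltsWithin_terminalEntries {i : Fin 2} {u : Fin n} {τ : RAMState}
    {D : CutVertex n → CutVertex n → Prop} (r0 : τ.reg 0 = 0) (r1 : τ.reg 1 = 1)
    (r3 : τ.reg 3 = 2 + 2 * n) (r9 : τ.reg 9 = (R i).block u)
    (r10 : τ.reg 10 = numbering n (copy i u))
    (r20 : τ.reg 20 = (numbering n (copy i u) : ℕ) * (2 + 2 * n))
    (r24 : τ.reg 24 = (R i).b + 1) (hW : Written R D τ) :
    HaltsWithin RAMProg.terminalEntries τ 12 fun υ =>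
      Written R (fun x y => D x y ∨ ∃ a, x = copy i u ∧ y = Sum.inl a ∨ y = copy i u ∧ x = Sum.inl a)
        υ ∧ υ.reg 22 = (numbering n (copy i u) : ℕ) * (2 + 2 * n) ∧
        υ.reg 15 = (R i).b + 1 - (R i).block u := by
  have hlast : ∀ w w' : ℕ, w = (if ((R i).block u : ℕ) = 0 then 2 else 0) →
      w' = (if (R i).b + 1 - ((R i).block u : ℕ) = 0 then 2 else 0) → Written R
      (fun x y => D x y ∨ ∃ a, x = copy i u ∧ y = Sum.inl a ∨ y = copy i u ∧ x = Sum.inl a)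
      ((((τ.setArr 6 ((numbering n (copy i u) : ℕ) * (2 + 2 * n)) w).setArr 6
        (numbering n (copy i u) : ℕ) w).setArr 6
        ((numbering n (copy i u) : ℕ) * (2 + 2 * n) + 1) w').setArr 6
        (2 + 2 * n + (numbering n (copy i u) : ℕ)) w') := by
    intro w w' hw hw'
    refine ((((hW.store (copy i u) src ?_ ?_).store src (copy i u) ?_ ?_).store (copy i u) snk
      ?_ ?_).store snk (copy i u) ?_ ?_).mono ?_
    -- The terminals have the numbers `0` and `1`, so the four addresses need no multiplication
    -- beyond the start of the row.
    · simp [numbering, src]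
    · rw [hw, entry_copy_src]
    · simp [numbering, src]
    · rw [hw, entry_src_copy]
    · simp [numbering, snk]
    · rw [hw', entry_copy_snk]
    · simp [numbering, snk]
    · rw [hw', entry_snk_copy]
    · rintro x y (h | ⟨a, ⟨rfl, rfl⟩ | ⟨rfl, rfl⟩⟩)
      · tauto
      · match a with
        | 0 => exact Or.inl (Or.inl (Or.inl (Or.inr ⟨rfl, rfl⟩)))
        | 1 => exact Or.inl (Or.inr ⟨rfl, rfl⟩)
      · match a with
        | 0 => exact Or.inl (Or.inl (Or.inr ⟨rfl, rfl⟩))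
        | 1 => exact Or.inr ⟨rfl, rfl⟩
  refine (HaltsWithin.of_wp ?_).mono
    (by simp [RAMProg.terminalEntries, RAMProg.block, RAMProg.time]) fun _ => id
  simp only [RAMProg.terminalEntries, RAMProg.block, RAMProg.wp, RAMState.setArr_setReg]
  simp [r0, r1, r3, r9, r10, r20, r24, written_setReg, -Fin.exists_fin_two]
  simp only [block_eq_zero_iff]
  refine ⟨fun h => ⟨fun h' => hlast _ _ ?_ ?_, fun h' => hlast _ _ ?_ ?_⟩,
    fun h => ⟨fun h' => hlast _ _ ?_ ?_, fun h' => hlast _ _ ?_ ?_⟩⟩ <;>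
    first
    | exact (if_pos h).symm
    | exact (if_neg h).symm
    | exact (if_pos h').symm
    | exact (if_neg h').symm

theorem haltsWithin_rowBody {i i' : Fin 2} (hi : i ≠ i') {u : Fin n} {τ : RAMState}
    {aB aE : ℕ} (haB : aB ≠ 6) (haE : aE ≠ 6) {D : CutVertex n → CutVertex n → Prop}
    (hrep : HoldsRep (R i) aB aE τ) (hb : (R i).b ≤ n) (r0 : τ.reg 0 = 0) (r1 : τ.reg 1 = 1)
    (r2 : τ.reg 2 = n) (r3 : τ.reg 3 = 2 + 2 * n) (r7 : τ.reg 7 = 2 + n * i)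
    (r8 : τ.reg 8 = u + 1) (r23 : τ.reg 23 = 2 + n * i') (r24 : τ.reg 24 = (R i).b + 1)
    (hW : Written R D τ) :
    HaltsWithin (RAMProg.rowBody aB aE) τ (34 * n + 40) fun υ =>
      Written R (fun x y => D x y ∨ x = copy i u ∨ y = copy i u ∧ ∃ a, x = Sum.inl a) υ ∧
        υ.reg 8 = u := by
  have hrow : 2 + n * i + (u : ℕ) = numbering n (copy i u) := by
    rw [numbering_copy]
    omega
  have hlt := (numbering n (copy i u)).2
  have hblock := ((R i).block u).2
  -- The two products cost time linear in the row number, below `2 + 2 * n`, and in the block label,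
  -- at most `b + 1 ≤ n + 1`.
  refine (HaltsWithin.wp_seq (T := (3 * (2 + 2 * n) + 3) + (12 + ((3 * (n + 1) + 3) +
    (2 + (n * (24 + 1) + 1))))) ?_).mono (by simp only [RAMProg.block, RAMProg.time]; omega)
    fun _ => id
  simp only [RAMProg.block, RAMProg.wp, RAMState.reg_setReg_self, RAMState.arr_setReg]
  simp [r1, r7, r8, hrep.1, hrow, -Fin.exists_fin_two]
  refine HaltsWithin.seq (HaltsWithin.mul (by simpa) (by simpa) (by decide) (by decide) (by decide)
    (by simp) ?_)
  refine HaltsWithin.seq ((haltsWithin_terminalEntries (i := i) (u := u) (R := R) (D := D)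
    ?_ ?_ ?_ ?_ ?_ ?_ ?_ ?_).frame.mono le_rfl ?_)
  · simpa
  · simpa
  · simpa
  · simp
  · simp
  · simp [r3]
  · simpa
  · simpa [written_setReg]
  rintro τ₁ ⟨⟨hW₁, h22, h15⟩, hf⟩
  have f0 : τ₁.reg 0 = 0 := (hf.reg 0 (by decide)).trans (by simpa)
  have f1 : τ₁.reg 1 = 1 := (hf.reg 1 (by decide)).trans (by simpa)
  have f2 : τ₁.reg 2 = n := (hf.reg 2 (by decide)).trans (by simpa)
  have f7 : τ₁.reg 7 = 2 + n * i := (hf.reg 7 (by decide)).trans (by simpa)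
  have f8 : τ₁.reg 8 = u := (hf.reg 8 (by decide)).trans (by simp)
  have f9 : τ₁.reg 9 = (R i).block u := (hf.reg 9 (by decide)).trans (by simp)
  have f23 : τ₁.reg 23 = 2 + n * i' := (hf.reg 23 (by decide)).trans (by simpa)
  have f24 : τ₁.reg 24 = (R i).b + 1 := (hf.reg 24 (by decide)).trans (by simpa)
  have fB : τ₁.arr aB = τ.arr aB := (hf.arr aB (by
    simpa [RAMProg.terminalEntries, RAMProg.block, RAMProg.arrs] using haB)).trans (by simp)
  have fE : τ₁.arr aE = τ.arr aE := (hf.arr aE (by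
    simpa [RAMProg.terminalEntries, RAMProg.block, RAMProg.arrs] using haE)).trans (by simp)
  clear hf
  refine HaltsWithin.seq (HaltsWithin.mul f0 f1 (by decide) (by decide) (by decide) (by omega) ?_)
  refine HaltsWithin.wp_seq ?_
  simp only [RAMProg.wp]
  simp [f0, f2, f9, f24, -Fin.exists_fin_two]
  refine (HaltsWithin.for_loop (T := 24) (n := n) (fun j τ => Written R (fun x y => (D x y ∨
    ∃ a, x = copy i u ∧ y = Sum.inl a ∨ y = copy i u ∧ x = Sum.inl a) ∨
      (x = copy i u ∧ ∃ k, ∃ v : Fin n, j ≤ (v : ℕ) ∧ y = copy k v)) τ) (by simp) ?_ ?_).frame.mono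
        le_rfl ?_
  · refine Written.mono (by simpa [written_setReg, -Fin.exists_fin_two] using hW₁) ?_
    rintro x y (h | ⟨-, k, v, hv, -⟩)
    · exact h
    · exact absurd v.2 (by omega)
  · intro j υ hυ hj hlt hf
    replace hf : (RAMProg.colBody 0 0).Frame _ υ := ⟨hf.reg, hf.arr⟩
    have hregs : RowRegs (R i) i i' u υ := by
      constructor
      · exact (hf.reg _ (by decide)).trans (by simpa)
      · exact (hf.reg _ (by decide)).trans (by simpa)
      · exact (hf.reg _ (by decide)).trans (by simpa)
      · exact (hf.reg _ (by decide)).trans (by simpa)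
      · exact (hf.reg _ (by decide)).trans (by simpa)
      · exact (hf.reg _ (by decide)).trans (by rw [← numbering_copy]; simpa)
      · exact (hf.reg _ (by decide)).trans (by simpa)
      · exact (hf.reg _ (by decide)).trans (by simpa)
      · exact (hf.reg _ (by decide)).trans (by simp)
    have ha : ∀ a, a ≠ 6 → υ.arr a = τ₁.arr a := fun a ha => (hf.arr a (by
      simpa [RAMProg.colBody, RAMProg.linkValue, RAMProg.diagValue, RAMProg.block, RAMProg.arrs]
        using ha)).trans (by simp)
    refine (haltsWithin_colBody hi (v := ⟨j, hlt⟩) (hrep.congr ((ha aB haB).trans fB)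
      ((ha aE haE).trans fE)) hregs hj hυ).mono le_rfl fun ω hω => ⟨hω.1.mono ?_, hω.2⟩
    rintro x y (h | ⟨rfl, k, v, hv, rfl⟩)
    · exact Or.inl (Or.inl h)
    · rcases hv.eq_or_lt with h | h
      · exact Or.inr ⟨rfl, k, by rw [show v = ⟨j, hlt⟩ from Fin.ext h.symm]⟩
      · exact Or.inl (Or.inr ⟨rfl, k, v, h, rfl⟩)
  · rintro υ ⟨hυ, hf⟩
    replace hf : (RAMProg.loop 11 (RAMProg.colBody 0 0)).Frame _ υ := ⟨hf.reg, hf.arr⟩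
    refine ⟨hυ.mono ?_, (hf.reg 8 (by decide)).trans (by simpa)⟩
    rintro x y (h | rfl | ⟨rfl, a, rfl⟩)
    · exact Or.inl (Or.inl h)
    · rcases y with a | ⟨k, v⟩
      · exact Or.inl (Or.inr ⟨a, Or.inl ⟨rfl, rfl⟩⟩)
      · exact Or.inr ⟨rfl, k, v, Nat.zero_le _, rfl⟩
    · exact Or.inl (Or.inr ⟨a, Or.inr ⟨rfl, rfl⟩⟩)

theorem haltsWithin_layer {i i' : Fin 2} (hi : i ≠ i') {τ : RAMState} {aB aE rb o o' : ℕ}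
    (haB : aB ≠ 6) (haE : aE ≠ 6) (ho' : o' ≠ 7) (hrb7 : rb ≠ 7) (hrb23 : rb ≠ 23)
    {D : CutVertex n → CutVertex n → Prop} (hrep : HoldsRep (R i) aB aE τ) (hb : (R i).b ≤ n)
    (r0 : τ.reg 0 = 0) (r1 : τ.reg 1 = 1) (r2 : τ.reg 2 = n) (r3 : τ.reg 3 = 2 + 2 * n)
    (ro : τ.reg o = 2 + n * i) (ro' : τ.reg o' = 2 + n * i') (rrb : τ.reg rb = (R i).b)
    (hW : Written R D τ) :
    HaltsWithin (RAMProg.layer aB aE rb o o') τ (n * (34 * n + 41) + 5)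
      (Written R (fun x y => D x y ∨ ∃ u, x = copy i u ∨ y = copy i u ∧ ∃ a, x = Sum.inl a)) := by
  refine (HaltsWithin.wp_seq (T := n * (34 * n + 40 + 1) + 1) ?_).mono
    (by simp only [RAMProg.block, RAMProg.time, add_assoc, Nat.reduceAdd]; omega) fun _ => id
  simp only [RAMProg.block, RAMProg.wp]
  -- Registers `7` and `23` are overwritten before `rb` is read, and `7` before `o'` is read; hence
  -- the inequalities.
  simp [r0, r1, r2, ro, ro', rrb, ho', hrb7, hrb23, -Fin.exists_fin_two]
  refine (HaltsWithin.for_loop (T := 34 * n + 40) (n := n) (fun j τ => Written R (fun x y => D x y ∨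
    ∃ u : Fin n, j ≤ (u : ℕ) ∧ (x = copy i u ∨ y = copy i u ∧ ∃ a, x = Sum.inl a)) τ)
      (by simp) ?_ ?_).mono le_rfl ?_
  · refine Written.mono (by simpa [written_setReg] using hW) ?_
    rintro x y (h | ⟨u, hu, -⟩)
    · exact h
    · exact absurd u.2 (by omega)
  · intro j υ hυ hj hlt hf
    replace hf : (RAMProg.rowBody 0 0).Frame _ υ := ⟨hf.reg, hf.arr⟩
    refine (haltsWithin_rowBody hi (u := ⟨j, hlt⟩) haB haE
      (hrep.congr ((hf.arr aB ?_).trans (by simp)) ((hf.arr aE ?_).trans (by simp))) hb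
      ((hf.reg 0 (by decide)).trans (by simpa)) ((hf.reg 1 (by decide)).trans (by simpa))
      ((hf.reg 2 (by decide)).trans (by simpa)) ((hf.reg 3 (by decide)).trans (by simpa))
      ((hf.reg 7 (by decide)).trans (by simp)) hj ((hf.reg 23 (by decide)).trans (by simp))
      ((hf.reg 24 (by decide)).trans (by simp)) hυ).mono le_rfl fun ω hω => ⟨hω.1.mono ?_, hω.2⟩
    · simpa [RAMProg.rowBody, RAMProg.terminalEntries, RAMProg.mul, RAMProg.colBody,
        RAMProg.linkValue, RAMProg.diagValue, RAMProg.block, RAMProg.arrs] using haB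
    · simpa [RAMProg.rowBody, RAMProg.terminalEntries, RAMProg.mul, RAMProg.colBody,
        RAMProg.linkValue, RAMProg.diagValue, RAMProg.block, RAMProg.arrs] using haE
    rintro x y (h | ⟨u, hu, h⟩)
    · exact Or.inl (Or.inl h)
    · rcases hu.eq_or_lt with h' | h'
      · obtain rfl : u = ⟨j, hlt⟩ := Fin.ext h'.symm
        exact Or.inr h
      · exact Or.inl (Or.inr ⟨u, h', h⟩)
  · intro υ hυ
    exact hυ.mono fun x y h => h.imp_right fun ⟨u, hu⟩ => ⟨u, Nat.zero_le _, hu⟩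

theorem HoldsInstance.of_frame {d : ℕ} {σ τ : RAMState} (h : HoldsInstance R d σ)
    (ha : ∀ a < 5, τ.arr a = σ.arr a) : HoldsInstance R d τ := by
  obtain ⟨h1, h2, h3, h4, h5, h6⟩ := h
  exact ⟨by rw [ha 0 (by decide), h1], by rw [ha 0 (by decide), h2], by rw [ha 0 (by decide), h3],
    by rw [ha 0 (by decide), h4], h5.congr (ha 1 (by decide)) (ha 2 (by decide)),
    h6.congr (ha 3 (by decide)) (ha 4 (by decide))⟩

theorem haltsWithin_build {d : ℕ} {σ : RAMState} (h : HoldsInstance R d σ)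
    (hb : ∀ i, (R i).b ≤ n) :
    HaltsWithin RAMProg.build σ (2 * (n * (34 * n + 41)) + 27) fun τ =>
      HoldsInstance R d τ ∧ HoldsNetwork (numbering n) (combinedNetwork R) τ := by
  obtain ⟨hn, hd, hb0, hb1, hrep0, hrep1⟩ := id h
  suffices H : HaltsWithin RAMProg.build σ (2 * (n * (34 * n + 41)) + 27) fun τ =>
      (τ.arr 5 0 = 2 + 2 * n ∧ τ.arr 5 1 = 0 ∧ τ.arr 5 2 = 1) ∧ Written R (fun _ _ => True) τ by
    refine H.frame.mono le_rfl ?_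
    rintro τ ⟨⟨h5, hW⟩, hf⟩
    refine ⟨h.of_frame fun a ha => ?_, h5.1, ?_, ?_, fun x y => hW x y trivial⟩
    · refine hf.arr a ?_
      interval_cases a <;> decide
    · rw [h5.2.1]
      simp [combinedNetwork, numbering, src]
    · rw [h5.2.2]
      simp [combinedNetwork, numbering, snk]
  refine (HaltsWithin.wp_seq (T := (n * (34 * n + 41) + 5) + (n * (34 * n + 41) + 5)) ?_).mono
    (by simp only [RAMProg.block, RAMProg.time]; omega) fun _ => id
  · simp only [RAMProg.block, RAMProg.wp]
    simp [hn, hb0, hb1, RAMState.setArr_setReg, -Fin.exists_fin_two]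
    refine HaltsWithin.seq ((haltsWithin_layer (R := R) (i := 0) (i' := 1)
      (D := fun x y => ∃ a b, x = Sum.inl a ∧ y = Sum.inl b) (by decide) (by decide) (by decide)
      (by decide) (by decide) (by decide) (hrep0.congr (by simp) (by simp)) (hb 0) (by simp)
      (by simp) (by simp) (by simp; omega) (by simp) (by simp; omega) (by simp) ?_).frame.mono
      le_rfl ?_)
    · rintro x y ⟨a, b, rfl, rfl⟩
      rw [entry_inl_inl]
      simp only [RAMState.arr_setReg, RAMState.arr_setArr_self, numbering, Equiv.trans_apply]
      simp
      intro h1 h2 h3 h4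
      match a, b with
      | 0, 0 => exact absurd rfl (h4 rfl)
      | 0, 1 => simp at h3
      | 1, 0 => simp at h2; omega
      | 1, 1 => simp at h1; omega
    rintro τ ⟨hW, hf⟩
    have fa := fun a ha => hf.arr a (by simpa [RAMProg.layer, RAMProg.rowBody,
      RAMProg.terminalEntries, RAMProg.mul, RAMProg.colBody,
      RAMProg.linkValue, RAMProg.diagValue, RAMProg.block, RAMProg.arrs] using ha)
    refine (haltsWithin_layer (R := R) (i := 1) (i' := 0)
      (by decide) (by decide) (by decide)
      (by decide) (by decide) (by decide) (hrep1.congr ((fa 3 (by decide)).trans (by simp))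
        ((fa 4 (by decide)).trans (by simp))) (hb 1)
      ((hf.reg 0 (by decide)).trans (by simp)) ((hf.reg 1 (by decide)).trans (by simp))
      ((hf.reg 2 (by decide)).trans (by simp)) ((hf.reg 3 (by decide)).trans (by simp; omega))
      ((hf.reg 19 (by decide)).trans (by simp; omega)) ((hf.reg 18 (by decide)).trans (by simp))
      ((hf.reg 5 (by decide)).trans (by simp)) hW).frame.mono le_rfl ?_
    rintro υ ⟨hW', hf'⟩
    have ga := fun a ha => hf'.arr a (by simpa [RAMProg.layer, RAMProg.rowBody,
      RAMProg.terminalEntries, RAMProg.mul, RAMProg.colBody,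
      RAMProg.linkValue, RAMProg.diagValue, RAMProg.block, RAMProg.arrs] using ha)
    refine ⟨?_, hW'.mono ?_⟩
    · rw [ga 5 (by decide), fa 5 (by decide)]
      simp [RAMState.arr_setArr_self]
      omega
    -- A place between terminals was zeroed at the start, one from a terminal to a copy belongs to
    -- the layer of its column, and all others to the layer of their row.
    · rintro (a | ⟨k, u⟩) (b | ⟨l, v⟩) -
      · exact Or.inl (Or.inl ⟨a, b, rfl, rfl⟩)
      · match l with
        | 0 => exact Or.inl (Or.inr ⟨v, Or.inr ⟨rfl, a, rfl⟩⟩)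
        | 1 => exact Or.inr ⟨v, Or.inr ⟨rfl, a, rfl⟩⟩
      all_goals
        match k with
        | 0 => exact Or.inl (Or.inr ⟨u, Or.inl rfl⟩)
        | 1 => exact Or.inr ⟨u, Or.inl rfl⟩

end Build

/-! ## Residual matrices and minimum cuts -/

/-- The total value of the entries of the `m × m` matrix `r` that lead out of `Z`. -/
def cutSum (m : ℕ) (r : ℕ → ℕ → ℕ) (Z : Finset ℕ) : ℕ :=
  ∑ x ∈ Finset.range m, ∑ y ∈ Finset.range m, if x ∈ Z ∧ y ∉ Z then r x y else 0

theorem cutSum_congr {m : ℕ} {r r' : ℕ → ℕ → ℕ} {Z : Finset ℕ}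
    (h : ∀ x < m, ∀ y < m, x ∈ Z → y ∉ Z → r x y = r' x y) : cutSum m r Z = cutSum m r' Z := by
  refine Finset.sum_congr rfl fun x hx => Finset.sum_congr rfl fun y hy => ?_
  split_ifs with hZ
  · exact h x (Finset.mem_range.1 hx) y (Finset.mem_range.1 hy) hZ.1 hZ.2
  · rfl

theorem cutSum_add {m : ℕ} (r r' : ℕ → ℕ → ℕ) (Z : Finset ℕ) :
    cutSum m (fun x y => r x y + r' x y) Z = cutSum m r Z + cutSum m r' Z := by
  simp only [cutSum, ← Finset.sum_add_distrib]
  refine Finset.sum_congr rfl fun x _ => Finset.sum_congr rfl fun y _ => ?_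
  split_ifs <;> simp

theorem cutSum_indicator {m x y : ℕ} (hx : x < m) (hy : y < m) (Z : Finset ℕ) :
    cutSum m (fun a b => if a = x ∧ b = y then 1 else 0) Z = if x ∈ Z ∧ y ∉ Z then 1 else 0 := by
  rw [cutSum, Finset.sum_eq_single_of_mem x (Finset.mem_range.2 hx),
    Finset.sum_eq_single_of_mem y (Finset.mem_range.2 hy)]
  · simp
  · intro b _ hb
    simp [hb]
  · intro a _ ha
    simp [ha]

/-- The effect of one unit of flow from `x` to `y` on the values of cuts. -/
theorem cutSum_push {m x y : ℕ} {r r' : ℕ → ℕ → ℕ} (hx : x < m) (hy : y < m)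
    (h : ∀ a < m, ∀ b < m, r' a b + (if a = x ∧ b = y then 1 else 0) =
      r a b + if a = y ∧ b = x then 1 else 0) (Z : Finset ℕ) :
    cutSum m r' Z + (if x ∈ Z then 1 else 0) = cutSum m r Z + if y ∈ Z then 1 else 0 := by
  have := cutSum_congr (m := m) (Z := Z) fun a ha b hb _ _ => h a ha b hb
  rw [cutSum_add, cutSum_add, cutSum_indicator hx hy, cutSum_indicator hy hx] at this
  by_cases hxZ : x ∈ Z <;> by_cases hyZ : y ∈ Z <;> simp_all

theorem cutSum_le {m B : ℕ} {r : ℕ → ℕ → ℕ} {Z : Finset ℕ}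
    (h : ∀ x < m, ∀ y < m, x ∈ Z → y ∉ Z → r x y ≤ B) : cutSum m r Z ≤ m * (m * B) := by
  have h1 : ∀ x ∈ Finset.range m,
      (∑ y ∈ Finset.range m, if x ∈ Z ∧ y ∉ Z then r x y else 0) ≤ m * B := fun x hx => by
    have h2 : ∀ y ∈ Finset.range m, (if x ∈ Z ∧ y ∉ Z then r x y else 0) ≤ B := fun y hy => by
      split_ifs with hZ
      · exact h x (Finset.mem_range.1 hx) y (Finset.mem_range.1 hy) hZ.1 hZ.2
      · exact Nat.zero_le _
    simpa using Finset.sum_le_card_nsmul _ _ _ h2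
  unfold cutSum
  simpa using Finset.sum_le_card_nsmul _ _ _ h1

theorem le_cutSum {m x y : ℕ} (r : ℕ → ℕ → ℕ) {Z : Finset ℕ} (hx : x < m) (hy : y < m)
    (hxZ : x ∈ Z) (hyZ : y ∉ Z) : r x y ≤ cutSum m r Z := by
  refine le_trans ?_ (Finset.single_le_sum (fun _ _ => Nat.zero_le _) (Finset.mem_range.2 hx))
  refine le_trans ?_ (Finset.single_le_sum (fun _ _ => Nat.zero_le _) (Finset.mem_range.2 hy))
  simp [hxZ, hyZ]

/-- The matrix `r` arises from `c` by a flow of value `F` from `s` to `t`. -/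
def IsResidual (m s t : ℕ) (c r : ℕ → ℕ → ℕ) (F : ℕ) : Prop :=
  ∀ Z : Finset ℕ, s ∈ Z → t ∉ Z → cutSum m r Z + F = cutSum m c Z

/-- No entry of `r` leads out of `S`. -/
def IsClosedUnder (m : ℕ) (r : ℕ → ℕ → ℕ) (S : Finset ℕ) : Prop :=
  ∀ x < m, ∀ y < m, x ∈ S → 0 < r x y → y ∈ S

/-- Weak duality: every cut has capacity at least `F`, and `S`, whose residual value is `0`, has
capacity exactly `F`. -/
theorem IsResidual.le_of_isClosedUnder {m s t F : ℕ} {c r : ℕ → ℕ → ℕ} {S Z : Finset ℕ}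
    (h : IsResidual m s t c r F) (hS : IsClosedUnder m r S) (hs : s ∈ S) (ht : t ∉ S)
    (hs' : s ∈ Z) (ht' : t ∉ Z) : cutSum m c S ≤ cutSum m c Z := by
  have h0 : cutSum m r S ≤ m * (m * 0) := cutSum_le fun x hx y hy hxS hyS => by
    by_contra h
    exact hyS (hS x hx y hy hxS (by omega))
  have := h S hs ht
  have := h Z hs' ht'
  simp at h0
  omega

/-! ### From networks with infinite costs to matrices of numbers -/

section Transport

variable {W : Type} {m : ℕ} (e : W ≃ Fin m)

/-- The numbers of the members of `Z`. -/
def Finset.numbers (Z : Finset W) : Finset ℕ := Z.map (e.toEmbedding.trans Fin.valEmbedding)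

theorem Finset.mem_numbers {Z : Finset W} {x : W} : (e x : ℕ) ∈ Z.numbers e ↔ x ∈ Z := by
  simp [Finset.numbers, Fin.val_inj]

/-- The matrix with the finite number `m * m + 1` in place of the infinite costs. -/
def IsCapacity (N : Network W) (c : ℕ → ℕ → ℕ) : Prop :=
  ∀ x y, c (e x) (e y) = if N.entry x y ≤ 1 then N.entry x y else m * m + 1

theorem entry_le_one_iff {N : Network W} {x y : W} :
    N.entry x y ≤ 1 ↔ ¬ (N.Adj x y ∧ N.cost x y = ⊤) := by
  unfold Network.entry
  split_ifs <;> simp_all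

variable [Fintype W]

theorem cutSum_numbers (c : ℕ → ℕ → ℕ) (Z : Finset W) [DecidableEq W] :
    cutSum m c (Z.numbers e) = ∑ x, ∑ y, if x ∈ Z ∧ y ∉ Z then c (e x) (e y) else 0 := by
  rw [cutSum, Finset.sum_range, ← e.sum_comp]
  refine Finset.sum_congr rfl fun x _ => ?_
  rw [Finset.sum_range, ← e.sum_comp]
  refine Finset.sum_congr rfl fun y _ => ?_
  simp only [Finset.mem_numbers]

variable {e} {N : Network W}

theorem cutCost_eq_top {Z : Finset W} (h : ∃ x y, x ∈ Z ∧ y ∉ Z ∧ ¬ N.entry x y ≤ 1) :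
    N.cutCost Z = ⊤ := by
  classical
  obtain ⟨x, y, hx, hy, hxy⟩ := h
  rw [entry_le_one_iff, not_not] at hxy
  rw [Network.cutCost]
  refine WithTop.sum_eq_top.2 ⟨(x, y), ?_, hxy.2⟩
  simp only [Finset.mem_filter]
  exact ⟨Finset.mem_univ _, hx, hy, hxy.1⟩

theorem cutCost_eq_cutSum {c : ℕ → ℕ → ℕ} (hN : N.UnitOrInfinite) (hc : IsCapacity e N c)
    {Z : Finset W} (h : ¬ ∃ x y, x ∈ Z ∧ y ∉ Z ∧ ¬ N.entry x y ≤ 1) :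
    N.cutCost Z = (cutSum m c (Z.numbers e) : ℕ∞) ∧ cutSum m c (Z.numbers e) ≤ m * m := by
  classical
  push Not at h
  constructor
  · rw [Network.cutCost, cutSum_numbers, Finset.sum_filter, Fintype.sum_prod_type, Nat.cast_sum]
    refine Finset.sum_congr rfl fun x _ => ?_
    rw [Nat.cast_sum]
    refine Finset.sum_congr rfl fun y _ => ?_
    by_cases hZ : x ∈ Z ∧ y ∉ Z
    · have hle := h x y hZ.1 hZ.2
      rw [hc, if_pos hle, if_pos hZ, Network.entry]
      rw [entry_le_one_iff] at hle
      by_cases hA : N.Adj x y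
      · rcases hN x y hA with h1 | h1
        · simp [hA, h1, hZ.1, hZ.2]
        · exact absurd ⟨hA, h1⟩ hle
      · simp [hA]
    · rw [if_neg fun h => hZ ⟨h.1, h.2.1⟩, if_neg hZ, Nat.cast_zero]
  · have : cutSum m c (Z.numbers e) ≤ m * (m * 1) := cutSum_le fun x hx y hy hxZ hyZ => by
      obtain ⟨x, rfl⟩ : ∃ w, (e w : ℕ) = x := ⟨e.symm ⟨x, hx⟩, by simp⟩
      obtain ⟨y, rfl⟩ : ∃ w, (e w : ℕ) = y := ⟨e.symm ⟨y, hy⟩, by simp⟩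
      rw [Finset.mem_numbers] at hxZ hyZ
      rw [hc, if_pos (h x y hxZ hyZ)]
      exact h x y hxZ hyZ
    simpa using this

/-- A cut that an infinite edge leaves has capacity at least `m * m + 1`, any other cut at most `m *
m`. So if some cut has finite cost, the minimizer of the capacities has finite cost, and on such
cuts capacity and cost agree. -/
theorem isMinCut_of_cutSum_le {c : ℕ → ℕ → ℕ} (hN : N.UnitOrInfinite) (hc : IsCapacity e N c)
    {Z : Finset W} (hZ : N.IsCut Z)
    (h : ∀ Z', N.IsCut Z' → cutSum m c (Z.numbers e) ≤ cutSum m c (Finset.numbers e Z')) :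
    N.IsMinCut Z := by
  refine ⟨hZ, fun Z' hZ' => ?_⟩
  by_cases h' : ∃ x y, x ∈ Z' ∧ y ∉ Z' ∧ ¬ N.entry x y ≤ 1
  · rw [cutCost_eq_top h']
    exact le_top
  · obtain ⟨h1, h2⟩ := cutCost_eq_cutSum hN hc h'
    have h3 := h Z' hZ'
    have h4 : ¬ ∃ x y, x ∈ Z ∧ y ∉ Z ∧ ¬ N.entry x y ≤ 1 := by
      rintro ⟨x, y, hx, hy, hxy⟩
      have := le_cutSum c (e x).2 (e y).2 ((Finset.mem_numbers e).2 hx)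
        (fun h => hy ((Finset.mem_numbers e).1 h))
      rw [hc, if_neg hxy] at this
      omega
    rw [(cutCost_eq_cutSum hN hc h4).1, h1]
    exact_mod_cast h3

theorem isMinCut_of_isClosedUnder {c r : ℕ → ℕ → ℕ} {F : ℕ} (hN : N.UnitOrInfinite)
    (hc : IsCapacity e N c) (hr : IsResidual m (e N.s) (e N.t) c r F) {S : Finset ℕ}
    (hS : IsClosedUnder m r S) (hs : (e N.s : ℕ) ∈ S) (ht : (e N.t : ℕ) ∉ S) :
    N.IsMinCut (Finset.univ.filter fun x => (e x : ℕ) ∈ S) := by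
  -- `S` may contain numbers that belong to no vertex; they do not matter.
  have hS' : ∀ x < m, x ∈ S ↔ x ∈ (Finset.univ.filter fun x => (e x : ℕ) ∈ S).numbers e := by
    intro x hx
    obtain ⟨x, rfl⟩ : ∃ w, (e w : ℕ) = x := ⟨e.symm ⟨x, hx⟩, by simp⟩
    simp [Finset.mem_numbers]
  refine isMinCut_of_cutSum_le hN hc ⟨by simpa, by simpa⟩ fun Z' hZ' => ?_
  refine hr.le_of_isClosedUnder (fun x hx y hy hxS hxy => ?_) ((hS' _ (e N.s).2).1 hs)
    (fun h => ht ((hS' _ (e N.t).2).2 h)) ((Finset.mem_numbers e).2 hZ'.1)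
    (fun h => hZ'.2 ((Finset.mem_numbers e).1 h))
  exact (hS' y hy).1 (hS x hx y hy ((hS' x hx).2 hxS) hxy)

end Transport

/-! ## Augmenting paths on a random access machine -/

namespace RAMProg

/-- The entries of the `m × m` matrix in array `6` that are at least `2` become `m * m + 1`. -/
def replaceInfinite : RAMProg :=
  seq (mul 2 2) (seq (block [add 5 20 1, add 7 20 0])
    (loop 7 (block [sub 7 7 1, load 8 6 7, sub 8 8 1, ite 8 (store 6 7 5) (const 8 0)])))

/-- One test whether an edge leads from a reached vertex `reg 12` to a new vertex. -/
def sweepEntry : RAMProg :=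
  block [sub 13 13 1, load 14 7 12, load 15 7 13, add 16 20 13, load 17 6 16,
    ite 14
      (ite 15 (const 16 0)
        (ite 17 (block [store 7 13 1, store 10 13 12, const 11 1]) (const 16 0)))
      (const 16 0)]

/-- One test of all edges. Register `11` tells whether a new vertex has been reached. -/
def sweep : RAMProg :=
  seq (block [const 11 0, add 12 2 0])
    (loop 12 (seq (sub 12 12 1) (seq (mul 12 2) (seq (add 13 2 0) (loop 13 sweepEntry)))))

/-- Array `7` receives the set of the vertices that can be reached from `s`, and array `10` their
predecessors. -/
def reach : RAMProg :=
  seq (add 10 2 0)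
    (seq (loop 10 (block [sub 10 10 1, store 7 10 0]))
      (seq (block [store 7 3 1, const 11 1]) (loop 11 sweep)))

/-- One unit of flow on the edge from the predecessor of `reg 12` to `reg 12`. -/
def pushEdge : RAMProg :=
  seq (load 14 10 12) (seq (mul 14 2)
    (seq (block [add 15 20 12, load 16 6 15, sub 16 16 1, store 6 15 16]) (seq (mul 12 2)
      (block [add 15 20 14, load 16 6 15, add 16 16 1, store 6 15 16, add 12 14 0, sub 13 12 3,
        sub 16 3 12, add 13 13 16]))))

/-- One unit of flow on the path that leads to `t` in the tree of predecessors. -/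
def augment : RAMProg :=
  seq (block [add 12 4 0, sub 13 12 3, sub 16 3 12, add 13 13 16]) (loop 13 pushEdge)

/-- The program that computes minimum cuts of networks with costs in `{1, ∞}` by augmenting
paths. -/
def minCut : RAMProg :=
  seq (block [const 0 0, const 1 1, const 6 2, load 2 5 0, load 3 5 1, load 4 5 6])
    (seq replaceInfinite
      (seq (const 9 1)
        (loop 9 (seq reach (seq (load 14 7 4) (ite 14 augment (const 9 0)))))))

end RAMProg

/-- The residual matrix in array `6`. -/
def RAMState.residual (σ : RAMState) (m x y : ℕ) : ℕ := σ.arr 6 (x * m + y)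

/-- The registers with the parameters of the network. -/
structure NetRegs (m s t : ℕ) (σ : RAMState) : Prop where
  reg0 : σ.reg 0 = 0
  reg1 : σ.reg 1 = 1
  reg2 : σ.reg 2 = m
  reg3 : σ.reg 3 = s
  reg4 : σ.reg 4 = t

theorem NetRegs.of_frame {m s t : ℕ} {σ τ : RAMState} {p : RAMProg} (h : NetRegs m s t σ)
    (hf : p.Frame σ τ) (hp : ∀ x < 5, x ∉ p.regs) : NetRegs m s t τ :=
  ⟨(hf.reg 0 (hp 0 (by decide))).trans h.reg0, (hf.reg 1 (hp 1 (by decide))).trans h.reg1,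
    (hf.reg 2 (hp 2 (by decide))).trans h.reg2, (hf.reg 3 (hp 3 (by decide))).trans h.reg3,
    (hf.reg 4 (hp 4 (by decide))).trans h.reg4⟩

theorem NetRegs.setReg {m s t : ℕ} {σ : RAMState} (h : NetRegs m s t σ) {x : ℕ} (hx : 5 ≤ x)
    (v : ℕ) : NetRegs m s t (σ.setReg x v) := by
  constructor <;> rw [RAMState.reg_setReg_of_ne _ _ (by omega)]
  exacts [h.reg0, h.reg1, h.reg2, h.reg3, h.reg4]

theorem NetRegs.setArr {m s t : ℕ} {σ : RAMState} (h : NetRegs m s t σ) (a i v : ℕ) :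
    NetRegs m s t (σ.setArr a i v) := ⟨h.reg0, h.reg1, h.reg2, h.reg3, h.reg4⟩

theorem haltsWithin_replaceInfinite {m s t : ℕ} {σ : RAMState} (h : NetRegs m s t σ) :
    HaltsWithin RAMProg.replaceInfinite σ (m * m * 6 + 3 * m + 6) fun τ =>
      ∀ k < m * m, τ.arr 6 k = if σ.arr 6 k ≤ 1 then σ.arr 6 k else m * m + 1 := by
  refine (HaltsWithin.seq (T := 3 * m + 3) (T' := 2 + (m * m * (5 + 1) + 1))
    (HaltsWithin.mul h.reg0 h.reg1 (by decide) (by decide) (by decide) h.reg2.le ?_)).mono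
      (by omega) fun _ => id
  refine HaltsWithin.wp_seq ?_
  simp only [RAMProg.block, RAMProg.wp]
  simp [h.reg0, h.reg1, h.reg2]
  refine (HaltsWithin.for_loop (T := 5) (n := m * m) (fun j τ => ∀ k < m * m, τ.arr 6 k =
    if j ≤ k then (if σ.arr 6 k ≤ 1 then σ.arr 6 k else m * m + 1) else σ.arr 6 k)
      (by simp) ?_ ?_).mono le_rfl ?_
  · intro k hk
    rw [if_neg (by omega)]
    simp
  · intro j τ hI hj hlt hf
    have f1 : τ.reg 1 = 1 := (hf.reg 1 (by decide)).trans (by simpa using h.reg1)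
    have f5 : τ.reg 5 = m * m + 1 := (hf.reg 5 (by decide)).trans (by simp)
    have hI0 := hI j hlt
    rw [if_neg (by omega)] at hI0
    refine (HaltsWithin.of_wp ?_).mono (by simp [RAMProg.time]) fun _ => id
    simp only [RAMProg.wp]
    simp [f1, f5, hj, hI0, RAMState.arr_setArr_self]
    refine ⟨fun h1 k hk => ?_, fun h1 k hk => ?_⟩ <;>
    · have := hI k hk
      grind
  · intro τ hI k hk
    simpa using hI k hk

/-- The set `S` with the predecessors `pred` is a tree with root `s` in the support of `r`, and
`rank` grows along its edges. -/
structure IsTree (m s : ℕ) (r : ℕ → ℕ → ℕ) (pred : ℕ → ℕ) (S : Finset ℕ) (rank : ℕ → ℕ) :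
    Prop where
  root : s ∈ S
  lt : ∀ y ∈ S, y < m
  edge : ∀ y ∈ S, y ≠ s → pred y ∈ S ∧ 0 < r (pred y) y ∧ rank (pred y) < rank y
  rank_lt : ∀ y ∈ S, rank y < S.card

theorem IsTree.card_le {m s : ℕ} {r : ℕ → ℕ → ℕ} {pred rank : ℕ → ℕ} {S : Finset ℕ}
    (h : IsTree m s r pred S rank) : S.card ≤ m := by
  simpa using Finset.card_le_card fun y hy => Finset.mem_range.2 (h.lt y hy)

/-- The new vertex gets the rank `S.card`, which exceeds all earlier ranks and is below the new
cardinality. -/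
theorem IsTree.insert {m s x y : ℕ} {r : ℕ → ℕ → ℕ} {pred rank : ℕ → ℕ} {S : Finset ℕ}
    (h : IsTree m s r pred S rank) (hx : x ∈ S) (hy : y ∉ S) (hym : y < m) (hr : 0 < r x y) :
    IsTree m s r (Function.update pred y x) (insert y S) (Function.update rank y S.card) := by
  have hne : ∀ z ∈ S, z ≠ y := fun z hz hzy => hy (hzy ▸ hz)
  constructor
  · exact Finset.mem_insert_of_mem h.root
  · intro z hz
    rcases Finset.mem_insert.1 hz with rfl | hz
    exacts [hym, h.lt z hz]
  · intro z hz hzs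
    rcases Finset.mem_insert.1 hz with rfl | hz
    · simp [hx, hr, hne x hx, h.rank_lt x hx]
    · obtain ⟨h1, h2, h3⟩ := h.edge z hz hzs
      simp [hne z hz, hne _ h1, h1, h2, h3]
  · intro z hz
    rw [Finset.card_insert_of_notMem hy]
    rcases Finset.mem_insert.1 hz with rfl | hz
    · simp
    · have := h.rank_lt z hz
      simp [hne z hz]
      omega

/-- Array `7` holds the set `S`, and array `10` holds the predecessors of a tree on `S`. -/
structure HoldsTree (m s : ℕ) (S : Finset ℕ) (σ : RAMState) : Prop where
  arr : ∀ v < m, σ.arr 7 v = if v ∈ S then 1 else 0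
  tree : ∃ rank, IsTree m s (σ.residual m) (σ.arr 10) S rank

theorem haltsWithin_sweepEntry {m s t x y : ℕ} {S : Finset ℕ} {τ : RAMState}
    (h : NetRegs m s t τ) (hS : HoldsTree m s S τ) (hx : x < m) (hy : y < m)
    (r12 : τ.reg 12 = x) (r13 : τ.reg 13 = y + 1) (r20 : τ.reg 20 = x * m) :
    HaltsWithin RAMProg.sweepEntry τ 11 fun υ => υ.reg 13 = y ∧ ∃ S', HoldsTree m s S' υ ∧
      ((υ.reg 11 = τ.reg 11 ∧ S' = S ∧ (x ∈ S → 0 < τ.residual m x y → y ∈ S)) ∨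
        υ.reg 11 = 1 ∧ S.card < S'.card) := by
  obtain ⟨rank, htree⟩ := hS.tree
  refine (HaltsWithin.of_wp ?_).mono
    (by simp [RAMProg.sweepEntry, RAMProg.block, RAMProg.time]) fun _ => id
  simp only [RAMProg.sweepEntry, RAMProg.block, RAMProg.wp]
  simp [r12, r13, r20, h.reg1, hS.arr x hx, hS.arr y hy]
  refine ⟨fun hxS => ⟨fun hyS => ?_, fun hyS => ⟨fun hr => ?_, fun hr => ?_⟩⟩, fun hxS => ?_⟩
  · exact ⟨S, ⟨hS.arr, rank, htree⟩, Or.inl ⟨rfl, fun _ _ => hyS⟩⟩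
  · refine ⟨insert y S, ⟨fun v hv => ?_, _, htree.insert hxS hyS hy (Nat.pos_of_ne_zero hr)⟩,
      Or.inr (by simp [Finset.card_insert_of_notMem hyS])⟩
    simp [RAMState.arr_setArr_self]
    have := hS.arr v hv
    grind
  · exact ⟨S, ⟨hS.arr, rank, htree⟩, Or.inl ⟨rfl, fun _ h => absurd hr h.ne'⟩⟩
  · exact ⟨S, ⟨hS.arr, rank, htree⟩, Or.inl ⟨rfl, fun h => absurd h hxS⟩⟩

/-- The invariant of a sweep that started with `k` reached vertices and has tested the pairs
in `P`. -/
def SweepInv (m s k : ℕ) (P : ℕ → ℕ → Prop) (τ : RAMState) : Prop :=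
  ∃ S, HoldsTree m s S τ ∧ k ≤ S.card ∧ (τ.reg 11 ≠ 0 → k < S.card) ∧
    (τ.reg 11 = 0 → ∀ x y, P x y → x ∈ S → 0 < τ.residual m x y → y ∈ S)

theorem HoldsTree.congr {m s : ℕ} {S : Finset ℕ} {σ τ : RAMState} (h : HoldsTree m s S σ)
    (ha : τ.arr = σ.arr) : HoldsTree m s S τ := by
  obtain ⟨h1, h2⟩ := h
  refine ⟨by rwa [ha], ?_⟩
  unfold RAMState.residual at h2 ⊢
  rwa [ha]

theorem SweepInv.congr {m s k : ℕ} {P P' : ℕ → ℕ → Prop} {σ τ : RAMState}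
    (h : SweepInv m s k P σ) (ha : τ.arr = σ.arr) (h11 : τ.reg 11 = σ.reg 11)
    (hP : ∀ x y, P' x y → P x y) : SweepInv m s k P' τ := by
  obtain ⟨S, hS, h1, h2, h3⟩ := h
  refine ⟨S, hS.congr ha, h1, by rwa [h11], fun h0 x y hxy => ?_⟩
  unfold RAMState.residual at h3 ⊢
  rw [ha]
  exact h3 (h11 ▸ h0) x y (hP x y hxy)

/-- Once a vertex is added, register `11` stays `1` until the end of the sweep. If it is `0` at the
end, the set was the same during all tests, so these certify closure together. -/
theorem haltsWithin_sweep {m s t : ℕ} {S : Finset ℕ} {σ : RAMState} (h : NetRegs m s t σ)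
    (hS : HoldsTree m s S σ) :
    HaltsWithin RAMProg.sweep σ (m * (15 * m + 7) + 3)
      (SweepInv m s S.card fun x y => x < m ∧ y < m) := by
  refine (HaltsWithin.wp_seq (T := m * ((15 * m + 6) + 1) + 1) ?_).mono
    (by simp only [RAMProg.block, RAMProg.time, add_assoc, Nat.reduceAdd]; omega) fun _ => id
  simp only [RAMProg.block, RAMProg.wp]
  refine (HaltsWithin.for_loop (n := m)
    (fun j => SweepInv m s S.card fun x y => j ≤ x ∧ x < m ∧ y < m) ?_ ?_ ?_).mono le_rfl ?_
  · simp [h.reg2, h.reg0]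
  · exact ⟨S, hS.congr rfl, le_rfl, by simp, fun _ x y hxy => by omega⟩
  · intro j τ hI hj hjm hf
    have hN : NetRegs m s t τ := ((h.setReg (by decide) _).setReg (by decide) _).of_frame hf
      (by decide)
    refine (HaltsWithin.wp_seq (T := (3 * m + 3) + (1 + (m * (11 + 1) + 1))) ?_).mono
      (by simp only [RAMProg.time]; omega) fun _ => id
    simp only [RAMProg.wp, hj, hN.reg1, Nat.add_sub_cancel]
    have hN' := hN.setReg (x := 12) (by decide) j
    refine HaltsWithin.seq (HaltsWithin.mul hN'.reg0 hN'.reg1 (by decide) (by decide) (by decide)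
      (by simpa using hjm.le) ?_)
    refine HaltsWithin.wp_seq ?_
    simp only [RAMProg.wp]
    simp [hN.reg0, hN.reg2]
    refine (HaltsWithin.for_loop (n := m) (fun i => SweepInv m s S.card fun x y =>
      j + 1 ≤ x ∧ x < m ∧ y < m ∨ x = j ∧ i ≤ y ∧ y < m) ?_ ?_ ?_).frame.mono le_rfl ?_
    · simp
    · refine hI.congr rfl (by simp) fun x y hxy => by omega
    · intro i υ hI' hi him hf'
      have hN'' : NetRegs m s t υ := ((((hN.setReg (by decide) _).setReg (by decide) _).setReg
        (by decide) _).setReg (by decide) _).of_frame hf' (by decide)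
      obtain ⟨S', hS', hk, h1, h0⟩ := hI'
      refine (haltsWithin_sweepEntry hN'' hS' hjm him ((hf'.reg 12 (by decide)).trans (by simp))
        hi ((hf'.reg 20 (by decide)).trans (by simp))).frame.mono le_rfl ?_
      rintro ω ⟨⟨hω, S'', hS'', hcase⟩, hf''⟩
      refine ⟨⟨S'', hS'', ?_⟩, hω⟩
      have hres : ω.residual m = υ.residual m := by
        unfold RAMState.residual
        rw [hf''.arr 6 (by decide)]
      rcases hcase with ⟨h11, rfl, hxy⟩ | ⟨h11, hlt⟩
      · rw [h11, hres]
        refine ⟨hk, h1, fun h11 x y hP => ?_⟩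
        by_cases hji : x = j ∧ y = i
        · obtain ⟨rfl, rfl⟩ := hji
          exact hxy
        · exact h0 h11 x y (by omega)
      · refine ⟨by omega, fun _ => by omega, fun h => by omega⟩
    · rintro υ ⟨hI', hf'⟩
      exact ⟨hI'.congr rfl rfl fun x y hxy => by omega, (hf'.reg 12 (by decide)).trans (by simp)⟩
  · exact fun τ hI => hI.congr rfl rfl fun x y hxy => by omega

theorem haltsWithin_reach {m s t : ℕ} {σ : RAMState} (h : NetRegs m s t σ) (hs : s < m) :
    HaltsWithin RAMProg.reach σ (m * (m * (15 * m + 7) + 4) + 3 * m + 5) fun τ =>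
      ∃ S, HoldsTree m s S τ ∧ IsClosedUnder m (τ.residual m) S := by
  refine (HaltsWithin.wp_seq (T := (m * (2 + 1) + 1) + (2 +
    (m * (m * (15 * m + 7) + 3 + 1) + 1))) ?_).mono
      (by simp only [RAMProg.time, add_assoc, Nat.reduceAdd]; omega) fun _ => id
  simp only [RAMProg.wp, h.reg0, h.reg2, add_zero]
  have h' := h.setReg (x := 10) (by decide) m
  refine HaltsWithin.seq ((HaltsWithin.for_loop (n := m) (fun j τ => ∀ v < m, j ≤ v →
    τ.arr 7 v = 0) (by simp) (fun v hv hv' => absurd hv (by omega)) ?_).frame.mono le_rfl ?_)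
  · intro j τ hI hj hjm hf
    have hN := h'.of_frame hf (by decide)
    refine HaltsWithin.of_wp ?_
    simp only [RAMProg.block, RAMProg.wp]
    simp [hj, hN.reg0, hN.reg1, RAMState.arr_setArr_self]
    intro v hv hjv hne
    exact hI v hv (by omega)
  rintro τ ⟨hI, hf⟩
  have hN := h'.of_frame hf (by decide)
  refine HaltsWithin.wp_seq ?_
  simp only [RAMProg.block, RAMProg.wp]
  have hN' := (hN.setArr 7 (τ.reg 3) (τ.reg 1)).setReg (x := 11) (by decide) 1
  -- Every sweep but the last adds a vertex, so `m` sweeps suffice when starting from `{s}`. The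
  -- condition `m < j + S.card`, with `S.card ≤ m`, keeps `j` positive while the loop runs.
  refine (HaltsWithin.loop (n := m) (fun j υ => ∃ S, HoldsTree m s S υ ∧
    (υ.reg 11 = 0 → IsClosedUnder m (υ.residual m) S) ∧ (υ.reg 11 ≠ 0 → m < j + S.card))
      ?_ ?_).mono le_rfl ?_
  · refine ⟨{s}, ⟨fun v hv => ?_, fun _ => 0, by simp, by simpa, by simp, by simp⟩, by simp,
      by simp⟩
    simp [RAMState.arr_setArr_self, hN.reg3, hN.reg1, hI v hv]
  · rintro j υ ⟨S, hS, h0, h1⟩ h11 hf'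
    obtain ⟨rank, htree⟩ := hS.tree
    have := htree.card_le
    have := h1 h11
    refine (haltsWithin_sweep (hN'.of_frame hf' (by decide)) hS).mono le_rfl ?_
    rintro ω ⟨S', hS', -, hlt, hcl⟩
    by_cases hω : ω.reg 11 = 0
    · exact ⟨0, by omega, S', hS', fun _ x hx y hy => hcl hω x y ⟨hx, hy⟩, fun h => absurd hω h⟩
    · have := hlt hω
      exact ⟨j - 1, by omega, S', hS', fun h => absurd h hω, fun _ => by omega⟩
  · rintro υ ⟨h11, j, S, hS, h0, -⟩
    exact ⟨S, hS, h0 h11⟩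

theorem IsTree.pred_lt {m s y : ℕ} {r : ℕ → ℕ → ℕ} {pred rank : ℕ → ℕ} {S : Finset ℕ}
    (h : IsTree m s r pred S rank) (hy : y ∈ S) (hys : y ≠ s) : pred y < m :=
  h.lt _ (h.edge y hy hys).1

theorem haltsWithin_pushEdge {m s t x y : ℕ} {τ : RAMState} (h : NetRegs m s t τ) (hx : x < m)
    (hy : y < m) (hxy : x ≠ y) (r12 : τ.reg 12 = y) (hpred : τ.arr 10 y = x)
    (hr : 0 < τ.residual m x y) :
    HaltsWithin RAMProg.pushEdge τ (6 * m + 19) fun υ => υ.reg 12 = x ∧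
      (υ.reg 13 = 0 ↔ x = s) ∧ ∀ a < m, ∀ b < m,
        υ.residual m a b + (if a = x ∧ b = y then 1 else 0) =
          τ.residual m a b + if a = y ∧ b = x then 1 else 0 := by
  -- The entry and its reverse occupy different cells, so the two updates do not interfere.
  have hne : y * m + x ≠ x * m + y := fun he => hxy (Nat.mul_add_inj hx hy he).2
  refine (HaltsWithin.wp_seq (T := (3 * m + 3) + (4 + ((3 * m + 3) + 8))) ?_).mono
    (by simp only [RAMProg.time]; omega) fun _ => id
  simp only [RAMProg.wp, r12, hpred]
  have hN := h.setReg (x := 14) (by decide) x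
  refine HaltsWithin.seq (HaltsWithin.mul hN.reg0 hN.reg1 (by decide) (by decide) (by decide)
    (by simpa using hx.le) ?_)
  refine HaltsWithin.wp_seq ?_
  simp only [RAMProg.block, RAMProg.wp]
  simp [h.reg1, h.reg2, r12]
  refine HaltsWithin.seq (HaltsWithin.mul (by simpa using h.reg0) (by simpa using h.reg1)
    (by decide) (by decide) (by decide) (by simpa [r12] using hy.le) ?_)
  refine (HaltsWithin.of_wp ?_).mono (by simp [RAMProg.time]) fun _ => id
  simp only [RAMProg.wp]
  simp [h.reg0, h.reg1, h.reg2, h.reg3, r12, RAMState.residual, RAMState.arr_setArr_self, hne]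
  refine ⟨by omega, fun a ha b hb => ?_⟩
  have h1 : a * m + b = x * m + y ↔ a = x ∧ b = y :=
    ⟨Nat.mul_add_inj hb hy, by rintro ⟨rfl, rfl⟩; rfl⟩
  have h2 : a * m + b = y * m + x ↔ a = y ∧ b = x :=
    ⟨Nat.mul_add_inj hb hx, by rintro ⟨rfl, rfl⟩; rfl⟩
  -- Positivity makes the truncated subtraction exact.
  have hr' : 0 < τ.arr 6 (x * m + y) := hr
  simp only [h1, h2]
  by_cases ha1 : a = x ∧ b = y
  · obtain ⟨rfl, rfl⟩ := ha1
    have : ¬ (a = b ∧ b = a) := fun h => hxy h.1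
    simp [hxy]
    omega
  · by_cases ha2 : a = y ∧ b = x
    · obtain ⟨rfl, rfl⟩ := ha2
      simp [hxy, hxy.symm]
    · simp [ha1, ha2]

theorem haltsWithin_augment {m s t F : ℕ} {S : Finset ℕ} {c : ℕ → ℕ → ℕ} {σ : RAMState}
    (h : NetRegs m s t σ) (hS : HoldsTree m s S σ) (ht : t ∈ S)
    (hr : IsResidual m s t c (σ.residual m) F) :
    HaltsWithin RAMProg.augment σ (m * (6 * m + 20) + 5) fun τ =>
      IsResidual m s t c (τ.residual m) (F + 1) := by
  obtain ⟨rank, htree⟩ := hS.tree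
  have hrank : rank t ≤ m := (htree.rank_lt t ht).le.trans htree.card_le
  refine (HaltsWithin.wp_seq (T := rank t * (6 * m + 19 + 1) + 1) ?_).mono ?_ fun _ => id
  swap
  · simp only [RAMProg.block, RAMProg.time, add_assoc, Nat.reduceAdd]
    have := Nat.mul_le_mul_right (6 * m + 20) hrank
    omega
  simp only [RAMProg.block, RAMProg.wp]
  simp [h.reg0, h.reg3, h.reg4]
  -- While the path is traced back from `t`, the unit pushed so far starts at the current vertex
  -- `y`. A cut has thus lost one more unit exactly if it contains `y`: none for `y = t`, and one in
  -- every cut for `y = s`.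
  refine (HaltsWithin.loop (n := rank t) (fun j τ => ∃ y ∈ S, τ.reg 12 = y ∧ rank y = j ∧
    (τ.reg 13 = 0 ↔ y = s) ∧
    (∀ v ∈ S, v ≠ s → rank v ≤ rank y → 0 < τ.residual m (σ.arr 10 v) v) ∧
    ∀ Z : Finset ℕ, s ∈ Z → t ∉ Z →
      cutSum m (τ.residual m) Z + F + (if y ∈ Z then 1 else 0) = cutSum m c Z) ?_ ?_).mono
        le_rfl ?_
  · refine ⟨t, ht, by simp, rfl, by simp; omega, fun v hv hvs _ => (htree.edge v hv hvs).2.1,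
      fun Z hs htZ => ?_⟩
    rw [if_neg htZ]
    exact hr Z hs htZ
  · rintro j τ ⟨y, hy, h12, rfl, h13, hpos, hcut⟩ hne hf
    have hys : y ≠ s := fun h => hne (h13.2 h)
    have hN : NetRegs m s t τ := ((((h.setReg (by decide) _).setReg (by decide) _).setReg
      (by decide) _).setReg (by decide) _).of_frame hf (by decide)
    have f10 : τ.arr 10 = σ.arr 10 := hf.arr 10 (by decide)
    obtain ⟨hpS, -, hlt⟩ := htree.edge y hy hys
    have hpy : σ.arr 10 y ≠ y := fun h => by rw [h] at hlt; exact lt_irrefl _ hlt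
    refine (haltsWithin_pushEdge hN (htree.lt _ hpS) (htree.lt y hy) hpy h12 (by rw [f10])
      (hpos y hy hys le_rfl)).mono le_rfl ?_
    rintro υ ⟨h12', h13', hres⟩
    refine ⟨_, hlt, _, hpS, h12', rfl, h13', fun v hv hvs hvr => ?_, fun Z hs htZ => ?_⟩
    -- Only the entry into `y` was lowered, and the tree edges still ahead enter vertices of smaller
    -- rank.
    · have h1 := hpos v hv hvs (hvr.trans hlt.le)
      have h2 := hres _ (htree.pred_lt hv hvs) v (htree.lt v hv)
      have hvy : v ≠ y := fun h => by subst h; omega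
      simp only [hvy, and_false, if_false] at h2
      omega
    · have := cutSum_push (htree.lt _ hpS) (htree.lt y hy) hres Z
      have := hcut Z hs htZ
      omega
  · rintro τ ⟨h0, j, y, -, -, -, h13, -, hcut⟩ Z hs htZ
    have := hcut Z hs htZ
    rw [if_pos (by rw [h13.1 h0]; exact hs)] at this
    omega

/-- A bound for the running time of one round of the minimum cut program. -/
def roundTime (m : ℕ) : ℕ :=
  m * (m * (15 * m + 7) + 4) + 3 * m + 5 + (1 + (m * (6 * m + 20) + 5 + 1))

/-- A bound for the running time of the minimum cut program. -/
def minCutTime (m : ℕ) : ℕ :=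
  6 + (m * m * 6 + 3 * m + 6 + (1 + ((m * (m * (m * m + 1)) + 1) * (roundTime m + 1) + 1)))

theorem haltsWithin_minCut {W : Type} [Fintype W] {m : ℕ} {e : W ≃ Fin m} {N : Network W}
    {σ : RAMState} (hN : N.UnitOrInfinite) (hσ : HoldsNetwork e N σ) :
    HaltsWithin RAMProg.minCut σ (minCutTime m) fun τ =>
      (∀ a < 5, τ.arr a = σ.arr a) ∧ ∃ Z, N.IsMinCut Z ∧ HoldsSet e Z 7 τ := by
  classical
  obtain ⟨hm, hs, ht, hentry⟩ := hσ
  set s : ℕ := ((e N.s : Fin m) : ℕ)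
  set t : ℕ := ((e N.t : Fin m) : ℕ)
  have hsm : s < m := (e N.s).2
  have htm : t < m := (e N.t).2
  have hst : t ≠ s := fun h => N.s_ne_t (e.injective (Fin.ext h.symm))
  suffices H : HaltsWithin RAMProg.minCut σ (minCutTime m) fun τ =>
      ∃ Z, N.IsMinCut Z ∧ HoldsSet e Z 7 τ by
    refine H.frame.mono le_rfl fun τ hτ => ⟨fun a ha => hτ.2.arr a ?_, hτ.1⟩
    interval_cases a <;> decide
  refine HaltsWithin.wp_seq (p := RAMProg.block _) ?_
  simp only [RAMProg.block, RAMProg.wp]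
  simp [hm, hs, ht]
  set σ₁ := (((((σ.setReg 0 0).setReg 1 1).setReg 6 2).setReg 2 m).setReg 3 s).setReg 4 t
  have hN₁ : NetRegs m s t σ₁ := by constructor <;> simp [σ₁]
  refine HaltsWithin.seq ((haltsWithin_replaceInfinite hN₁).frame.mono le_rfl ?_)
  rintro σ₂ ⟨h6, hf₂⟩
  have hN₂ := hN₁.of_frame hf₂ (by decide)
  set c := σ₂.residual m with hc_def
  have hc : IsCapacity e N c := fun x y => by
    have hx := (e x).2
    have hy := (e y).2
    have hlt : (e x : ℕ) * m + e y < m * m := by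
      have : ((e x : ℕ) + 1) * m ≤ m * m := Nat.mul_le_mul_right m hx
      linarith
    have : σ₁.arr 6 ((e x : ℕ) * m + e y) = N.entry x y := hentry x y
    rw [hc_def, RAMState.residual, h6 _ hlt, this]
  have hcle : ∀ x < m, ∀ y < m, c x y ≤ m * m + 1 := by
    intro x hx y hy
    obtain ⟨x, rfl⟩ : ∃ w, (e w : ℕ) = x := ⟨e.symm ⟨x, hx⟩, by simp⟩
    obtain ⟨y, rfl⟩ : ∃ w, (e w : ℕ) = y := ⟨e.symm ⟨y, hy⟩, by simp⟩
    rw [hc]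
    split_ifs <;> omega
  have hV : cutSum m c {s} ≤ m * (m * (m * m + 1)) :=
    cutSum_le fun x hx y hy _ _ => hcle x hx y hy
  refine HaltsWithin.wp_seq ?_
  simp only [RAMProg.wp]
  have hN₃ := hN₂.setReg (x := 9) (by decide) 1
  -- Each augmentation raises `F`, which never exceeds the capacity of the cut `{s}`. The extra `1`
  -- pays for the last round, which only finds that `t` is not reached.
  refine (HaltsWithin.loop (n := cutSum m c {s} + 1) (T := roundTime m) (fun j τ =>
    ∃ F, IsResidual m s t c (τ.residual m) F ∧ (τ.reg 9 ≠ 0 → F + j = cutSum m c {s} + 1) ∧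
      (τ.reg 9 = 0 → ∃ S, (∀ v < m, τ.arr 7 v = if v ∈ S then 1 else 0) ∧
        IsClosedUnder m (τ.residual m) S ∧ s ∈ S ∧ t ∉ S)) ?_ ?_).mono (by gcongr) ?_
  · exact ⟨0, fun Z _ _ => rfl, by simp, by simp⟩
  · rintro j τ ⟨F, hF, hj, -⟩ h9 hf
    have hNτ := hN₃.of_frame hf (by decide)
    have hj := hj h9
    have hFle := hF {s} (by simp) (by simpa using hst)
    refine HaltsWithin.seq ((haltsWithin_reach hNτ hsm).frame.mono le_rfl ?_)
    rintro υ ⟨⟨S, hS, hcl⟩, hfυ⟩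
    have hNυ := hNτ.of_frame hfυ (by decide)
    have h9υ : υ.reg 9 ≠ 0 := by rwa [hfυ.reg 9 (by decide)]
    have hres : υ.residual m = τ.residual m := by
      unfold RAMState.residual
      rw [hfυ.arr 6 (by decide)]
    rw [← hres] at hF
    refine HaltsWithin.wp_seq ?_
    simp only [RAMProg.wp, hNυ.reg4, hS.arr t htm]
    refine HaltsWithin.ite (fun h14 => ?_) (fun h14 => ?_)
    · have htS : t ∈ S := by
        by_contra h
        simp [h] at h14
      refine (haltsWithin_augment (hNυ.setReg (x := 14) (by decide) _) (hS.congr rfl) htS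
        hF).frame.mono le_rfl ?_
      rintro ω ⟨hω, hfω⟩
      have h9ω : ω.reg 9 ≠ 0 := by
        rw [hfω.reg 9 (by decide)]
        simpa using h9υ
      exact ⟨j - 1, by omega, F + 1, hω, fun _ => by omega, fun h => absurd h h9ω⟩
    · have htS : t ∉ S := by
        intro h
        simp [h] at h14
      obtain ⟨rank, htree⟩ := hS.tree
      refine (HaltsWithin.of_wp ?_).mono (by simp [RAMProg.time]) fun _ => id
      simp only [RAMProg.wp]
      exact ⟨0, by omega, F, hF, by simp, fun _ => ⟨S, hS.arr, hcl, htree.root, htS⟩⟩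
  · rintro τ ⟨h9, j, F, hF, -, hS⟩
    obtain ⟨S, hS7, hcl, hsS, htS⟩ := hS h9
    refine ⟨_, isMinCut_of_isClosedUnder hN hc hF hcl hsS htS, holdsSet_iff.2 fun x => ?_⟩
    rw [hS7 _ (e x).2]
    simp

/-- The polynomial that bounds the running time of the minimum cut program. -/
noncomputable def minCutPoly : Polynomial ℕ :=
  let X : Polynomial ℕ := .X
  6 + (X * X * 6 + 3 * X + 6 + (1 + ((X * (X * (X * X + 1)) + 1) *
    (X * (X * (15 * X + 7) + 4) + 3 * X + 5 + (1 + (X * (6 * X + 20) + 5 + 1)) + 1) + 1)))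

theorem eval_minCutPoly (m : ℕ) : minCutPoly.eval m = minCutTime m := by
  simp [minCutPoly, minCutTime, roundTime]

/-- The polynomial that bounds the running time of the whole algorithm. -/
noncomputable def totalPoly : Polynomial ℕ :=
  let X : Polynomial ℕ := .X
  2 * (X * (34 * X + 41)) + 27 + (minCutPoly + minCutPoly.comp (2 + 2 * X) + (12 * X + 15))

theorem eval_totalPoly (n : ℕ) : totalPoly.eval n = 2 * (n * (34 * n + 41)) + 27 +
    (minCutTime n + minCutTime (2 + 2 * n) + (12 * n + 15)) := by
  simp [totalPoly, eval_minCutPoly]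

/-! ### The complete algorithm -/

theorem combinedNetwork_unitOrInfinite {n : ℕ} (R : Fin 2 → CompactRep n) :
    (combinedNetwork R).UnitOrInfinite := by
  intro x y _
  by_cases h : BlockEdge R x y <;> simp [combinedNetwork, h]

theorem haltsWithin_finish_of_isMinCut {n d : ℕ} {f : Fin 2 → Finset (Fin n) → ℝ}
    {R : Fin 2 → CompactRep n} (hR : ∀ i, (R i).Represents (argminSets (f i))) {σ : RAMState}
    {Z : Finset (CutVertex n)} (hσ : HoldsInstance R d σ) (hZ : (combinedNetwork R).IsMinCut Z)
    (h7 : HoldsSet (CutVertex.numbering n) Z 7 σ) :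
    HaltsWithin RAMProg.finish σ (12 * n + 15) fun τ =>
      ((combinedNetwork R).cutCost Z ≤ ((2 * d : ℕ) : ℕ∞) ∧
        ∃ X, IsHalving (cutSide Z 0) (cutSide Z 1) X ∧ AnswersYes X τ) ∨
      (¬ (combinedNetwork R).cutCost Z ≤ ((2 * d : ℕ) : ℕ∞) ∧ AnswersNo τ) := by
  rw [hZ.cutCost_eq hR, Nat.cast_le]
  exact haltsWithin_finish hσ.1 hσ.2.1 h7

theorem mainTheorem2 :
    -- the minimum cut of the combined network decides the instance and yields a solution
    (∀ (n d : ℕ) (f : Fin 2 → Finset (Fin n) → ℝ) (R : Fin 2 → CompactRep n),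
      (∀ i, IsSubmodular (f i)) → (∀ i, (R i).Represents (argminSets (f i))) →
      ∀ Z, (combinedNetwork R).IsMinCut Z →
        (∀ i, cutSide Z i ∈ argminSets (f i)) ∧
        (combinedNetwork R).cutCost Z = ((symmDiff (cutSide Z 0) (cutSide Z 1)).card : ℕ∞) ∧
        IsLeast {c : ℕ∞ | ∃ Y₁ ∈ argminSets (f 0), ∃ Y₂ ∈ argminSets (f 1),
          c = ((symmDiff Y₁ Y₂).card : ℕ∞)} ((combinedNetwork R).cutCost Z) ∧
        ((combinedNetwork R).cutCost Z ≤ ((2 * d : ℕ) : ℕ∞) ↔ ∃ X, IsRobustSolution f d X) ∧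
        ((combinedNetwork R).cutCost Z ≤ ((2 * d : ℕ) : ℕ∞) →
          ∀ X, IsHalving (cutSide Z 0) (cutSide Z 1) X → IsRobustSolution f d X)) ∧
    -- the polynomial-time algorithm with a single minimum cut computation
    ∃ (build minCut finish : RAMProg) (p : Polynomial ℕ),
      -- `minCut` computes minimum cuts of networks with costs in `{1, ∞}`
      (∀ (W : Type) [Fintype W] (m : ℕ) (e : W ≃ Fin m) (N : Network W) (σ : RAMState),
        N.UnitOrInfinite → HoldsNetwork e N σ →
        HaltsWithin minCut σ (p.eval m) fun τ =>
          (∀ a < 5, τ.arr a = σ.arr a) ∧ ∃ Z, N.IsMinCut Z ∧ HoldsSet e Z 7 τ) ∧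
      ∀ (n d : ℕ) (f : Fin 2 → Finset (Fin n) → ℝ) (R : Fin 2 → CompactRep n),
        (∀ i, IsSubmodular (f i)) → (∀ i, (R i).Represents (argminSets (f i))) →
        -- `build` constructs the combined network
        (∀ σ, HoldsInstance R d σ → HaltsWithin build σ (p.eval n) fun τ =>
          HoldsInstance R d τ ∧ HoldsNetwork (CutVertex.numbering n) (combinedNetwork R) τ) ∧
        -- `finish` turns a minimum cut into the answer
        (∀ σ Z, HoldsInstance R d σ → (combinedNetwork R).IsMinCut Z →
          HoldsSet (CutVertex.numbering n) Z 7 σ →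
          HaltsWithin finish σ (p.eval n) fun τ =>
            ((combinedNetwork R).cutCost Z ≤ ((2 * d : ℕ) : ℕ∞) ∧
              ∃ X, IsHalving (cutSide Z 0) (cutSide Z 1) X ∧ AnswersYes X τ) ∨
            (¬ (combinedNetwork R).cutCost Z ≤ ((2 * d : ℕ) : ℕ∞) ∧ AnswersNo τ)) ∧
        -- together they solve the problem in polynomial time
        (∀ σ, HoldsInstance R d σ →
          HaltsWithin (.seq build (.seq minCut finish)) σ (p.eval n) fun τ =>
            (∃ X, IsRobustSolution f d X ∧ AnswersYes X τ) ∨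
            ((¬ ∃ X, IsRobustSolution f d X) ∧ AnswersNo τ)) := by
  refine ⟨fun n d f R _ hR Z hZ => ⟨hZ.cutSide_mem hR, hZ.cutCost_eq hR, hZ.isLeast hR,
    hZ.le_iff hR, fun hd X hX => hZ.isRobustSolution hR hd hX⟩,
    .build, .minCut, .finish, totalPoly, ?_, ?_⟩
  · intro W _ m e N σ hN hσ
    -- `totalPoly` has `minCutPoly` as a summand besides its value at `2 + 2 * X`, so one polynomial
    -- serves networks with `m` vertices and combined graphs alike.
    exact (haltsWithin_minCut hN hσ).mono (by rw [eval_totalPoly]; omega) fun _ => id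
  intro n d f R _ hR
  have hb : ∀ i, (R i).b ≤ n := fun i => (hR i).b_le
  refine ⟨fun σ hσ => (haltsWithin_build hσ hb).mono (by rw [eval_totalPoly]; omega) fun _ => id,
    fun σ Z hσ hZ h7 => (haltsWithin_finish_of_isMinCut hR hσ hZ h7).mono
      (by rw [eval_totalPoly]; omega) fun _ => id, fun σ hσ => ?_⟩
  refine HaltsWithin.mono (T := 2 * (n * (34 * n + 41)) + 27 +
    (minCutTime (2 + 2 * n) + (12 * n + 15))) (HaltsWithin.seq ?_)
    (by rw [eval_totalPoly]; omega) fun _ => id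
  refine (haltsWithin_build hσ hb).mono le_rfl fun τ hτ => HaltsWithin.seq ?_
  refine (haltsWithin_minCut (combinedNetwork_unitOrInfinite R) hτ.2).mono le_rfl ?_
  rintro υ ⟨hυ, Z, hZ, h7⟩
  -- The arrays below `5`, which hold the instance, have survived the cut computation.
  refine (haltsWithin_finish_of_isMinCut hR (hτ.1.of_frame hυ) hZ h7).mono le_rfl ?_
  rintro ω (⟨hd, X, hX, hω⟩ | ⟨hd, hω⟩)
  · exact Or.inl ⟨X, hZ.isRobustSolution hR hd hX, hω⟩
  · exact Or.inr ⟨fun h => hd ((hZ.le_iff hR).2 h), hω⟩
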